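/- Fix $\rho\in(-1,1)$ and, for every $p$, a design matrix $X=[x_1,\dots,x_p]\in\mathbb{R}^{n_p\times p}$ with $X'X=\mathrm{diag}(B,\dots,B,B_0)$, where $B=\begin{pmatrix}1&\rho\\ \rho&1\end{pmatrix}$, $B_0=B$ if $p$ is even and $B_0=1$ if $p$ is odd. For $\vartheta\in(0,1)$ and $r>0$ let $y=X\beta+z$, where $z\sim N(0,I_{n_p})$ is independent of $\beta$ and the $\beta_j$ are i.i.d., equal to $\sqrt{2r\log p}$ with probability $p^{-\vartheta}$ and to $0$ otherwise. The expected Hamming error of a rule that selects $\hat S\subset\{1,\dots,p\}$ from $y$ is $\mathbb{E}\bigl[\#\{j\in\hat S:\beta_j=0\}+\#\{j\notin\hat S:\beta_j\neq0\}\bigr]$. A rule has exponent $h$ at $(\vartheta,r)$ if its expected Hamming error equals $L_p\,p^{1-h}$ with $L_pp^{\epsilon}\to\infty$ and $L_pp^{-\epsilon}\to0$ as $p\to\infty$ for every $\epsilon>0$. For a method with a tuning parameter $q>0$, let $h(\vartheta,r)$ be the supremum of the exponents over $q>0$ (ideal tuning), and define its upper phase curve $U(\vartheta)=\inf\{r>0:h(\vartheta,r)>1\}\in[0,\infty]$,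 with $\inf\emptyset=\infty$. With $\lambda=\sqrt{2q\log p}$, consider: * the Elastic net with a fixed $\mu>0$, which selects the support of $\mathrm{argmin}_b\{\|y-Xb\|^2/2+\lambda\|b\|_1+(\mu/2)\|b\|^2\}$; its curve is $U_\mu$; * the Lasso, which selects the support of $\mathrm{argmin}_b\{\|y-Xb\|^2/2+\lambda\|b\|_1\}$; its curve is $U_{\mathrm{Lasso}}$; * marginal regression, which selects $\{j:|x_j'y|>\lambda\}$; its curve is $U_{\mathrm{MR}}$. **Proposition.** For each fixed $\vartheta\in(0,1)$, the map $\mu\mapsto U_\mu(\vartheta)$ is nondecreasing on $(0,\infty)$. As $\mu\to0^+$ it decreases to $U_{\mathrm{Lasso}}(\vartheta)$, and as $\mu\to\infty$ it increases to $U_{\mathrm{MR}}(\vartheta)$ (convergence in $[0,\infty]$). Furthermore, when $\rho\le-\tfrac12$, $U_{\mathrm{MR}}(\vartheta)=\infty$ for all $0<\vartheta\le\tfrac12$, and exact recovery by marginal regression is impossible no matter how large $r$ is: for all $r>0$ and $q>0$, the exponent of marginal regression exists and is at most $1$. -/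

import Mathlib

open MeasureTheory ProbabilityTheory Filter Topology
open scoped ENNReal Matrix

noncomputable section

namespace SparseRegression

/-- The `p × p` Gram matrix `diag(B, …, B, B₀)`, with `B = [[1, ρ], [ρ, 1]]`, where the last block is
`B₀ = B` if `p` is even and `B₀ = 1` if `p` is odd. With 0-based indices the blocks are
`{0, 1}, {2, 3}, …`. -/
def gramMatrix (ρ : ℝ) (p : ℕ) : Matrix (Fin p) (Fin p) ℝ :=
  Matrix.of fun i j => if i = j then 1 else if i.val / 2 = j.val / 2 then ρ else 0

/-- The law of the coefficient vector: i.i.d. coordinates, equal to `τ_p = √(2 r log p)` with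
probability `ε_p = p ^ (-ϑ)` and to `0` with probability `1 - ε_p`. -/
def coefLaw (ϑ r : ℝ) (p : ℕ) : Measure (Fin p → ℝ) :=
  Measure.pi fun _ =>
    ENNReal.ofReal (1 - (p : ℝ) ^ (-ϑ)) • Measure.dirac (0 : ℝ) +
      ENNReal.ofReal ((p : ℝ) ^ (-ϑ)) • Measure.dirac (Real.sqrt (2 * r * Real.log p))

/-- The standard Gaussian law `N(0, I_n)` of the noise. -/
def noiseLaw (n : ℕ) : Measure (Fin n → ℝ) :=
  Measure.pi fun _ => gaussianReal 0 1

/-- The Hamming error of a selected set `S`: false positives plus false negatives. -/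
def hammingError {p : ℕ} (S : Set (Fin p)) (β : Fin p → ℝ) : ℕ :=
  {j | j ∈ S ∧ β j = 0}.ncard + {j | j ∉ S ∧ β j ≠ 0}.ncard

/-- The expected Hamming error of a variable selection rule `S` (a map from the response `y` to the
set of selected variables) in the linear model `y = X β + z`, where `β` and `z` are independent. -/
def expectedHamming {n p : ℕ} (X : Matrix (Fin n) (Fin p) ℝ) (ϑ r : ℝ)
    (S : (Fin n → ℝ) → Set (Fin p)) : ℝ :=
  ∫ ω, (hammingError (S (X *ᵥ ω.1 + ω.2)) ω.1 : ℝ) ∂((coefLaw ϑ r p).prod (noiseLaw n))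

/-- `L_p` is a multi-`log(p)` term. -/
def IsMultiLog (L : ℕ → ℝ) : Prop :=
  ∀ ε : ℝ, 0 < ε →
    Tendsto (fun p : ℕ => L p * (p : ℝ) ^ ε) atTop atTop ∧
      Tendsto (fun p : ℕ => L p * (p : ℝ) ^ (-ε)) atTop (𝓝 0)

/-- `h` is the exponent of the sequence of expected Hamming errors `H`: `H p = L_p p ^ (1 - h)` for
a multi-`log(p)` term `L_p`. -/
def IsHammingExponent (H : ℕ → ℝ) (h : ℝ) : Prop :=
  ∃ L : ℕ → ℝ, IsMultiLog L ∧ ∀ᶠ p : ℕ in atTop, H p = L p * (p : ℝ) ^ (1 - h)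

/-- A minimizer of `F` (an arbitrary vector if there is none). -/
def argmin {p : ℕ} (F : (Fin p → ℝ) → ℝ) : Fin p → ℝ :=
  Classical.epsilon fun b => ∀ b', F b ≤ F b'

/-- The Elastic net estimator with tuning parameters `lam` and `μ`. Whenever `Xᵀ X` is positive
definite and `0 ≤ μ`, the minimizer exists and is unique. -/
def elasticNetEstimator {n p : ℕ} (X : Matrix (Fin n) (Fin p) ℝ) (lam μ : ℝ)
    (y : Fin n → ℝ) : Fin p → ℝ :=
  argmin fun b => (∑ i, (y i - (X *ᵥ b) i) ^ 2) / 2 + lam * ∑ j, |b j| + μ / 2 * ∑ j, b j ^ 2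

/-- The Lasso estimator with tuning parameter `lam`. -/
def lassoEstimator {n p : ℕ} (X : Matrix (Fin n) (Fin p) ℝ) (lam : ℝ)
    (y : Fin n → ℝ) : Fin p → ℝ :=
  argmin fun b => (∑ i, (y i - (X *ᵥ b) i) ^ 2) / 2 + lam * ∑ j, |b j|

/-- The threshold `√(2 q log p)`. -/
def level (q : ℝ) (p : ℕ) : ℝ := Real.sqrt (2 * q * Real.log p)

section Methods

variable {n : ℕ → ℕ} (X : ∀ p, Matrix (Fin (n p)) (Fin p) ℝ)

/-- Variable selection by the Elastic net with `λ = √(2 q log p)`. -/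
def elasticNet (μ q : ℝ) (p : ℕ) (y : Fin (n p) → ℝ) : Set (Fin p) :=
  {j | elasticNetEstimator (X p) (level q p) μ y j ≠ 0}

/-- Variable selection by the Lasso with `λ = √(2 q log p)`. -/
def lasso (q : ℝ) (p : ℕ) (y : Fin (n p) → ℝ) : Set (Fin p) :=
  {j | lassoEstimator (X p) (level q p) y j ≠ 0}

/-- Variable selection by marginal regression: `j` is selected if `|x_jᵀ y| > √(2 q log p)`. -/
def marginalRegression (q : ℝ) (p : ℕ) (y : Fin (n p) → ℝ) : Set (Fin p) :=
  {j | level q p < |((X p)ᵀ *ᵥ y) j|}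

/-- `h` is the exponent of the expected Hamming error of the selection rules `S`. -/
def IsRateExponent (ϑ r : ℝ) (S : ∀ p, (Fin (n p) → ℝ) → Set (Fin p)) (h : ℝ) : Prop :=
  IsHammingExponent (fun p => expectedHamming (X p) ϑ r (S p)) h

/-- The exponent `h(ϑ, r)` of the method `M` under an ideal choice of its tuning parameter `q > 0`:
the largest exponent that the choice of `q` can give. -/
def idealExponent (M : ℝ → ∀ p, (Fin (n p) → ℝ) → Set (Fin p)) (ϑ r : ℝ) : EReal :=
  ⨆ (q : ℝ) (_ : 0 < q) (h : ℝ) (_ : IsRateExponent X ϑ r (M q) h), (h : EReal)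

/-- The upper phase curve `U(ϑ) = inf {r > 0 : h(ϑ, r) > 1}` of the method `M`, with `inf ∅ = ∞`. -/
def upperPhaseCurve (M : ℝ → ∀ p, (Fin (n p) → ℝ) → Set (Fin p)) (ϑ : ℝ) : ℝ≥0∞ :=
  ⨅ (r : ℝ) (_ : 0 < r) (_ : 1 < idealExponent X M ϑ r), ENNReal.ofReal r

end Methods

end SparseRegression

end

noncomputable section

namespace SparseRegression

/-! All three methods belong to one family. Let `h₁`, `h₂` be the entries of `Xᵀ y` at a variable
and at its block partner. By the stationarity conditions the variable is selected exactly when `|h₁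
- η * soft u h₂| > u`, where `u` is the threshold and `η = s * ρ`, with `s = (1 + μ)⁻¹` for the
Elastic net, `s = 1` for the Lasso and `s = 0` for marginal regression
(`elasticNetEstimator_support`). The claims thus concern the dependence on `e = s * |ρ|`, which runs
over `[0, |ρ|]`.

After division by `√(2 log p)`, a Gaussian error event `A` has probability `p ^ (-rate A)` up to `p
^ o(1)`, where `rate A` is the squared distance from `A` to the origin (`hasOrder_gauss₂`). Each
nonzero coefficient costs a further `p ^ (-ϑ)`, so the exponent of a rule is the smallest of four
terms, one for each support of a block (`pairExponent`, `isHammingExponent_blockRule`).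

With `u = √q` and `v = √r`, the exponent exceeds one when the four rates exceed `1`, `1 - ϑ`, `1 -
ϑ` and `1 - 2ϑ`. These conditions amount to linear bounds on `u`. Eliminating `u` leaves the
explicit inequalities `PhaseCond` (`exists_one_lt_pairExponent_iff`).

As `e` increases to `|ρ|`, the standard deviation of `N₁ - e N₂` decreases and every inequality in
`PhaseCond` relaxes, which gives monotonicity. The inequalities are strict and continuous in `e`,
and increasing `v` creates slack, which gives both limits (`continuousWithinAt_phaseCurve`). At `e =
0` the last inequality has right side `v * (1 - 2|ρ|)`, which is nonpositive for `ρ ≤ -1/2`, so no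
signal strength suffices. -/

/-- Soft thresholding at level `u`. -/
def soft (u x : ℝ) : ℝ := x - max (-u) (min x u)

/-- The statistic which a selection rule compares, in absolute value, with the threshold `u`. -/
def score (η u h₁ h₂ : ℝ) : ℝ := h₁ - η * soft u h₂

/-- The score of the first variable of a block with coefficients `b₁`, `b₂`, when the noise has
coordinates `z` in an orthonormal basis adapted to the first column of the block. -/
def pairScore (ρ η u b₁ b₂ : ℝ) (z : ℝ × ℝ) : ℝ :=
  score η u (b₁ + ρ * b₂ + z.1) (ρ * b₁ + b₂ + ρ * z.1 + √(1 - ρ ^ 2) * z.2)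

/-- False positives. -/
def fpSet (ρ η u b : ℝ) : Set (ℝ × ℝ) := {z | u ≤ |pairScore ρ η u 0 b z|}

/-- False negatives. -/
def fnSet (ρ η u v b : ℝ) : Set (ℝ × ℝ) := {z | |pairScore ρ η u v b z| ≤ u}

/-- The squared Euclidean norm. -/
def normSq₂ (z : ℝ × ℝ) : ℝ := z.1 ^ 2 + z.2 ^ 2

/-- The Gaussian large deviation rate of a set. -/
def rate (A : Set (ℝ × ℝ)) : ℝ := sInf (normSq₂ '' A)

/-- The exponent of the error probability of a variable in a block of size two. -/
def pairExponent (ρ η ϑ u v : ℝ) : ℝ :=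
  min (min (rate (fpSet ρ η u 0)) (ϑ + rate (fpSet ρ η u v)))
    (min (ϑ + rate (fnSet ρ η u v 0)) (2 * ϑ + rate (fnSet ρ η u v v)))

/-! ### Elementary properties of soft thresholding -/

lemma normSq₂_nonneg (z : ℝ × ℝ) : 0 ≤ normSq₂ z := by unfold normSq₂; positivity

@[fun_prop]
lemma continuous_normSq₂ : Continuous normSq₂ := by unfold normSq₂; fun_prop

@[fun_prop]
lemma continuous_soft (u : ℝ) : Continuous (soft u) := by unfold soft; fun_prop

lemma soft_neg {u : ℝ} (_hu : 0 ≤ u) (x : ℝ) : soft u (-x) = -soft u x := by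
  unfold soft
  rcases le_total x u with h | h <;> rcases le_total (-x) u with h' | h' <;>
  simp only [min_def, max_def] <;> split_ifs <;> linarith

lemma soft_of_abs_le {u x : ℝ} (h : |x| ≤ u) : soft u x = 0 := by
  obtain ⟨h1, h2⟩ := abs_le.1 h
  simp [soft, min_eq_left h2, max_eq_right h1]

lemma soft_of_ge {u x : ℝ} (hu : 0 ≤ u) (h : u ≤ x) : soft u x = x - u := by
  simp [soft, min_eq_right h, max_eq_right (by linarith : -u ≤ u)]

lemma soft_of_le {u x : ℝ} (hu : 0 ≤ u) (h : x ≤ -u) : soft u x = x + u := by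
  simp [soft, min_eq_left (by linarith : x ≤ u), max_eq_left h]

lemma soft_le_add (u x : ℝ) : soft u x ≤ x + u := by
  unfold soft
  linarith [le_max_left (-u) (min x u)]

lemma soft_le_max (u x : ℝ) : soft u x ≤ max 0 (x - u) := by
  unfold soft
  rcases le_total x u with h | h
  · rw [min_eq_left h]
    exact le_max_of_le_left (by linarith [le_max_right (-u) x])
  · rw [min_eq_right h]
    exact le_max_of_le_right (by linarith [le_max_right (-u) u])

lemma soft_mul {t : ℝ} (ht : 0 ≤ t) (u x : ℝ) : soft (t * u) (t * x) = t * soft u x := by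
  unfold soft
  rw [mul_sub, mul_max_of_nonneg _ _ ht, mul_min_of_nonneg _ _ ht, mul_neg]

lemma abs_soft_sub_le (u x y : ℝ) : |soft u x - soft u y| ≤ |x - y| := by
  unfold soft
  wlog h : y ≤ x generalizing x y
  · rw [abs_sub_comm, abs_sub_comm x]
    exact this y x (by linarith)
  rw [abs_of_nonneg (by linarith : 0 ≤ x - y), abs_le]
  have h1 : max (-u) (min y u) ≤ max (-u) (min x u) := max_le_max le_rfl (min_le_min h le_rfl)
  have h2 : max (-u) (min x u) ≤ max (-u) (min y u) + (x - y) := by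
    refine max_le (by linarith [le_max_left (-u) (min y u)]) ?_
    have : min x u ≤ min y u + (x - y) := by
      rcases le_total y u with h' | h'
      · rw [min_eq_left h']; linarith [min_le_left x u]
      · rw [min_eq_right h']; linarith [min_le_right x u]
    linarith [le_max_right (-u) (min y u)]
  constructor <;> linarith

@[fun_prop]
lemma continuous_pairScore (ρ η u b₁ b₂ : ℝ) : Continuous (pairScore ρ η u b₁ b₂) := by
  unfold pairScore score
  fun_prop

lemma isClosed_fpSet (ρ η u b : ℝ) : IsClosed (fpSet ρ η u b) :=
  isClosed_le continuous_const (by fun_prop)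

lemma isClosed_fnSet (ρ η u v b : ℝ) : IsClosed (fnSet ρ η u v b) :=
  isClosed_le (by fun_prop) continuous_const

/-! ### Large deviation rates as squared distances to the origin -/

lemma bddBelow_normSq₂_image (A : Set (ℝ × ℝ)) : BddBelow (normSq₂ '' A) :=
  ⟨0, by rintro _ ⟨z, -, rfl⟩; exact normSq₂_nonneg z⟩

lemma rate_le {A : Set (ℝ × ℝ)} {z : ℝ × ℝ} (hz : z ∈ A) : rate A ≤ normSq₂ z :=
  csInf_le (bddBelow_normSq₂_image A) ⟨z, hz, rfl⟩

lemma rate_nonneg (A : Set (ℝ × ℝ)) : 0 ≤ rate A :=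
  Real.sInf_nonneg (by rintro _ ⟨z, -, rfl⟩; exact normSq₂_nonneg z)

/-- Nonemptiness matters: the infimum of the empty set of reals is `0`, so `rate ∅ = 0`. -/
lemma le_rate {A : Set (ℝ × ℝ)} (hA : A.Nonempty) {a : ℝ} (h : ∀ z ∈ A, a ≤ normSq₂ z) :
    a ≤ rate A :=
  le_csInf (hA.image _) (by rintro _ ⟨z, hz, rfl⟩; exact h z hz)

lemma exists_normSq₂_eq_rate {A : Set (ℝ × ℝ)} (hA : IsClosed A) (hne : A.Nonempty) :
    ∃ z ∈ A, normSq₂ z = rate A := by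
  obtain ⟨z₀, h₀⟩ := hne
  have hcoer : Tendsto normSq₂ (cocompact (ℝ × ℝ)) atTop := by
    refine tendsto_atTop_mono (fun z => ?_)
      ((tendsto_pow_atTop two_ne_zero).comp (tendsto_norm_cocompact_atTop (E := ℝ × ℝ)))
    simp only [Function.comp, normSq₂, Prod.norm_def, Real.norm_eq_abs]
    rcases le_total |z.1| |z.2| with h | h
    · rw [max_eq_right h, sq_abs]; nlinarith
    · rw [max_eq_left h, sq_abs]; nlinarith
  obtain ⟨z, hz, hmin⟩ := continuous_normSq₂.continuousOn.exists_isMinOn' hA h₀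
    ((hcoer.eventually_ge_atTop (normSq₂ z₀)).filter_mono inf_le_left)
  exact ⟨z, hz, le_antisymm (le_rate ⟨z, hz⟩ fun w hw => hmin hw) (rate_le hz)⟩

/-- On a closed set the rate is attained, so excluding a closed disc gives a strict bound. -/
lemma lt_rate {A : Set (ℝ × ℝ)} (hA : IsClosed A) (hne : A.Nonempty) {a : ℝ}
    (h : ∀ z, normSq₂ z ≤ a → z ∉ A) : a < rate A := by
  obtain ⟨z, hz, h'⟩ := exists_normSq₂_eq_rate hA hne
  rw [← h']
  by_contra hc
  exact h z (not_lt.1 hc) hz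

lemma rate_preimage {f : ℝ × ℝ → ℝ × ℝ} (hf : Function.Surjective f)
    (h : ∀ z, normSq₂ (f z) = normSq₂ z) (A : Set (ℝ × ℝ)) : rate (f ⁻¹' A) = rate A := by
  unfold rate
  congr 1
  ext x
  constructor
  · rintro ⟨z, hz, rfl⟩
    exact ⟨f z, hz, h z⟩
  · rintro ⟨z, hz, rfl⟩
    obtain ⟨w, rfl⟩ := hf z
    exact ⟨w, hz, (h w).symm⟩

/-! ### Sign symmetries of a block -/

/-- Replacing the second column of the block by its negative flips the correlation, the second
coefficient and `h₂`; soft thresholding is odd. Negative correlation is thereby traded for a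
negative partner coefficient. -/
lemma pairScore_neg_neg {u : ℝ} (hu : 0 ≤ u) (ρ η b₁ b₂ : ℝ) (z : ℝ × ℝ) :
    pairScore (-ρ) (-η) u b₁ b₂ z = pairScore ρ η u b₁ (-b₂) (z.1, -z.2) := by
  have h : (-ρ * b₁ + b₂ + -ρ * z.1 + √(1 - (-ρ) ^ 2) * z.2) =
      -(ρ * b₁ + -b₂ + ρ * z.1 + √(1 - ρ ^ 2) * -z.2) := by rw [neg_sq]; ring
  simp only [pairScore, score, h, soft_neg hu]
  ring

lemma pairScore_neg {u : ℝ} (hu : 0 ≤ u) (ρ η b₁ b₂ : ℝ) (z : ℝ × ℝ) :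
    pairScore ρ η u (-b₁) (-b₂) (-z) = -pairScore ρ η u b₁ b₂ z := by
  have h : (ρ * -b₁ + -b₂ + ρ * -z.1 + √(1 - ρ ^ 2) * -z.2) =
      -(ρ * b₁ + b₂ + ρ * z.1 + √(1 - ρ ^ 2) * z.2) := by ring
  simp only [pairScore, score, Prod.fst_neg, Prod.snd_neg, h, soft_neg hu]
  ring

lemma rate_fnSet_neg {u : ℝ} (hu : 0 ≤ u) (ρ η v b : ℝ) :
    rate (fnSet (-ρ) (-η) u v b) = rate (fnSet ρ η u v (-b)) := by
  rw [← rate_preimage (f := fun z => (z.1, -z.2)) (fun z => ⟨(z.1, -z.2), by simp⟩)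
    (fun z => by simp [normSq₂]) (fnSet ρ η u v (-b))]
  congr 1
  ext z
  simp [fnSet, pairScore_neg_neg hu]

/-- The first coefficient is `0` here, so a global sign change turns `-b` back into `b`. This fails
for false negatives, which is why only they feel the sign of `ρ`. -/
lemma rate_fpSet_neg {u : ℝ} (hu : 0 ≤ u) (ρ η b : ℝ) :
    rate (fpSet (-ρ) (-η) u b) = rate (fpSet ρ η u b) := by
  rw [← rate_preimage (f := fun z => (-z.1, z.2)) (fun z => ⟨(-z.1, z.2), by simp⟩)
    (fun z => by simp [normSq₂]) (fpSet ρ η u b)]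
  congr 1
  ext z
  have h := pairScore_neg hu ρ η 0 b (-z.1, z.2)
  simp only [neg_zero, Prod.neg_mk, neg_neg] at h
  simp [fpSet, pairScore_neg_neg hu, h]

/-! ### The standard deviation of the score and Cauchy–Schwarz bounds -/

section Nonneg

variable {k e u v : ℝ}

/-- The standard deviation of `N₁ - e N₂` when the unit variance variables `N₁`, `N₂` have
correlation `k`. -/
def scoreSD (k e : ℝ) : ℝ := √(1 - 2 * k * e + e ^ 2)

lemma scoreSD_eq (k e : ℝ) : scoreSD k e = √(1 - k ^ 2 + (k - e) ^ 2) := by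
  unfold scoreSD; congr 1; ring

lemma scoreSD_pos (hk : 0 ≤ k) (hk1 : k < 1) (e : ℝ) : 0 < scoreSD k e := by
  rw [scoreSD_eq]
  exact Real.sqrt_pos.2 (by nlinarith [sq_nonneg (k - e)])

lemma sq_scoreSD (hk : 0 ≤ k) (hk1 : k < 1) (e : ℝ) :
    scoreSD k e ^ 2 = 1 - 2 * k * e + e ^ 2 :=
  Real.sq_sqrt (by nlinarith [sq_nonneg (k - e)])

lemma scoreSD_anti {e e' : ℝ} (h : e ≤ e') (h' : e' ≤ k) : scoreSD k e' ≤ scoreSD k e := by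
  rw [scoreSD_eq, scoreSD_eq]
  exact Real.sqrt_le_sqrt (by nlinarith)

lemma scoreSD_le_one (he : 0 ≤ e) (hek : e ≤ k) : scoreSD k e ≤ 1 := by
  refine (scoreSD_anti he hek).trans (le_of_eq ?_)
  simp [scoreSD]

@[fun_prop]
lemma continuous_scoreSD (k : ℝ) : Continuous (scoreSD k) := by unfold scoreSD; fun_prop

lemma sq_kappa (hk : 0 ≤ k) (hk1 : k < 1) : √(1 - k ^ 2) ^ 2 = 1 - k ^ 2 :=
  Real.sq_sqrt (by nlinarith)

/-- Cauchy–Schwarz in the plane, via Lagrange's identity. -/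
lemma abs_linear_le {a b s c : ℝ} (hs : 0 ≤ s) (hc : 0 ≤ c) (h : a ^ 2 + b ^ 2 = s ^ 2)
    {z : ℝ × ℝ} (hz : normSq₂ z ≤ c ^ 2) : |a * z.1 + b * z.2| ≤ c * s := by
  refine abs_le_of_sq_le_sq ?_ (by positivity)
  unfold normSq₂ at hz
  nlinarith [sq_nonneg (a * z.2 - b * z.1), mul_le_mul_of_nonneg_left hz (sq_nonneg s)]

lemma abs_fst_le {c : ℝ} (hc : 0 ≤ c) {z : ℝ × ℝ} (hz : normSq₂ z ≤ c ^ 2) : |z.1| ≤ c :=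
  abs_le_of_sq_le_sq (by unfold normSq₂ at hz; nlinarith [sq_nonneg z.2]) hc

lemma abs_second_le (hk : 0 ≤ k) (hk1 : k < 1) {c : ℝ} (hc : 0 ≤ c) {z : ℝ × ℝ}
    (hz : normSq₂ z ≤ c ^ 2) : |k * z.1 + √(1 - k ^ 2) * z.2| ≤ c := by
  simpa using abs_linear_le (s := 1) zero_le_one hc
    (by rw [sq_kappa hk hk1]; ring) hz

lemma abs_diff_le (hk : 0 ≤ k) (hk1 : k < 1) {c : ℝ} (hc : 0 ≤ c) {z : ℝ × ℝ}
    (hz : normSq₂ z ≤ c ^ 2) :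
    |(1 - e * k) * z.1 + -(e * √(1 - k ^ 2)) * z.2| ≤ c * scoreSD k e := by
  refine abs_linear_le (scoreSD_pos hk hk1 e).le hc ?_ hz
  rw [sq_scoreSD hk hk1, neg_sq, mul_pow, sq_kappa hk hk1]; ring

end Nonneg

lemma kappa_pos {ρ : ℝ} (hρ : |ρ| < 1) : 0 < √(1 - ρ ^ 2) :=
  Real.sqrt_pos.2 (by nlinarith [(sq_lt_one_iff_abs_lt_one ρ).2 hρ])

/-- This direction of the noise moves `h₁` and leaves `h₂` unchanged, so the score moves by exactly
`δ`. It makes all error sets nonempty and gives access to their interiors. -/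
lemma pairScore_shift {ρ : ℝ} (hρ : |ρ| < 1) (η u b₁ b₂ δ : ℝ) (z : ℝ × ℝ) :
    pairScore ρ η u b₁ b₂ (z.1 + δ, z.2 - ρ * δ / √(1 - ρ ^ 2)) =
      pairScore ρ η u b₁ b₂ z + δ := by
  have hκ := (kappa_pos hρ).ne'
  have h : ρ * b₁ + b₂ + ρ * (z.1 + δ) + √(1 - ρ ^ 2) * (z.2 - ρ * δ / √(1 - ρ ^ 2)) =
      ρ * b₁ + b₂ + ρ * z.1 + √(1 - ρ ^ 2) * z.2 := by field_simp; ring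
  simp only [pairScore, score, h]
  ring

lemma pairScore_surjective {ρ : ℝ} (hρ : |ρ| < 1) (η u b₁ b₂ : ℝ) :
    Function.Surjective (pairScore ρ η u b₁ b₂) := fun y =>
  ⟨_, (pairScore_shift hρ η u b₁ b₂ (y - pairScore ρ η u b₁ b₂ 0) 0).trans (by ring)⟩

lemma fpSet_nonempty {ρ : ℝ} (hρ : |ρ| < 1) (η u b : ℝ) : (fpSet ρ η u b).Nonempty := by
  obtain ⟨z, hz⟩ := pairScore_surjective hρ η u 0 b u
  exact ⟨z, by simp [fpSet, hz, le_abs_self]⟩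

lemma fnSet_nonempty {ρ u : ℝ} (hρ : |ρ| < 1) (hu : 0 ≤ u) (η v b : ℝ) :
    (fnSet ρ η u v b).Nonempty := by
  obtain ⟨z, hz⟩ := pairScore_surjective hρ η u v b 0
  exact ⟨z, by simp [fnSet, hz, hu]⟩

/-! ### Necessary conditions: upper bounds on rates from explicit points -/

section Necessary

variable {ρ k e u v c d : ℝ}

/-- At the noise `(u, 0)` the partner statistic is `ρ * u`, which soft thresholding kills. -/
lemma rate_fpSet_zero_le (hρ : |ρ| < 1) (hu : 0 ≤ u) (η : ℝ) : rate (fpSet ρ η u 0) ≤ u ^ 2 := by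
  have h : soft u (ρ * u) = 0 := soft_of_abs_le (by rw [abs_mul, abs_of_nonneg hu]; nlinarith)
  simpa [normSq₂] using rate_le (A := fpSet ρ η u 0) (z := (u, 0))
    (by simp [fpSet, pairScore, score, h, le_abs_self])

lemma rate_fnSet_zero_le (hρ : |ρ| < 1) (hu : 0 ≤ u) (hv : 0 ≤ v) (η : ℝ) :
    rate (fnSet ρ η u v 0) ≤ max 0 (v - u) ^ 2 := by
  have key : ∀ w, 0 ≤ w → w ≤ u → soft u (ρ * w) = 0 := fun w h0 h =>
    soft_of_abs_le (by rw [abs_mul, abs_of_nonneg h0]; nlinarith [abs_nonneg ρ])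
  rcases le_total v u with h | h
  · simpa [normSq₂, h] using rate_le (A := fnSet ρ η u v 0) (z := (0, 0))
      (by simp [fnSet, pairScore, score, key v hv h, abs_of_nonneg hv, h])
  · have h2 : ρ * v + ρ * (u - v) = ρ * u := by ring
    have := rate_le (A := fnSet ρ η u v 0) (z := (u - v, 0))
      (by simp [fnSet, pairScore, score, h2, key u hu le_rfl, abs_of_nonneg hu])
    rw [max_eq_right (by linarith)]
    refine this.trans (le_of_eq ?_)
    simp [normSq₂]; ring

lemma add_lt_of_lt_rate_fnSet (hρ : |ρ| < 1) (hu : 0 ≤ u) (hv : 0 ≤ v) {η : ℝ}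
    (hc : 0 ≤ c) (h : c ^ 2 < rate (fnSet ρ η u v 0)) : u + c < v := by
  have h1 := abs_lt_of_sq_lt_sq (h.trans_le (rate_fnSet_zero_le hρ hu hv η)) (le_max_left _ _)
  rw [abs_of_nonneg hc] at h1
  rcases lt_max_iff.1 h1 with h2 | h2 <;> linarith

lemma lt_of_lt_rate_fpSet (hk : 0 ≤ k) (hk1 : k < 1) (hek : e ≤ k) (hu : 0 ≤ u)
    (huv : u ≤ v) (hc : 0 ≤ c) (h : c ^ 2 < rate (fpSet k e u v)) :
    (k - e) * v + c * scoreSD k e < (1 - e) * u := by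
  by_contra! hcon
  set σ := scoreSD k e with hσ
  have hσ0 : 0 < σ := scoreSD_pos hk hk1 e
  have hσ2 := sq_scoreSD hk hk1 e
  rw [← hσ] at hσ2
  have hκ := sq_kappa hk hk1
  set κ := √(1 - k ^ 2)
  -- The witness is `c` times the unit vector along `(1 - e k, -e κ)`, the direction of steepest
  -- ascent of `N₁ - e N₂`. Since `e ≤ k`, the partner noise there is nonnegative, so `h₂ ≥ v ≥ u`
  -- stays in the linear branch of `soft`.
  have hz2 : k * (c * (1 - e * k) / σ) + κ * (-(c * e * κ) / σ) = c * (k - e) / σ := by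
    field_simp
    linear_combination (-(e * c)) * hκ
  have hnn : 0 ≤ c * (k - e) / σ := div_nonneg (mul_nonneg hc (by linarith)) hσ0.le
  have hsum : c * (1 - e * k) / σ - e * (c * (k - e) / σ) = c * σ := by
    field_simp
    linear_combination (-c) * hσ2
  have hmem : (c * (1 - e * k) / σ, -(c * e * κ) / σ) ∈ fpSet k e u v := by
    have harg : k * 0 + v + k * (c * (1 - e * k) / σ) + κ * (-(c * e * κ) / σ) =
      v + c * (k - e) / σ := by linarith
    simp only [fpSet, Set.mem_ofPred_eq, pairScore, score]
    rw [harg, soft_of_ge hu (by linarith)]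
    refine le_trans ?_ (le_abs_self _)
    linarith
  have hle := rate_le hmem
  have hns : normSq₂ (c * (1 - e * k) / σ, -(c * e * κ) / σ) = c ^ 2 := by
    simp only [normSq₂]
    field_simp
    linear_combination c ^ 2 * (e ^ 2 * hκ - hσ2)
  linarith

lemma lt_of_lt_rate_fnSet_neg (hk : 0 ≤ k) (hk1 : k < 1) (he : 0 ≤ e) (hek : e ≤ k)
    (hu : 0 ≤ u) (hv : 0 ≤ v) (hd : 0 ≤ d) (h : d ^ 2 < rate (fnSet k e u v (-v))) :
    d * scoreSD k e < (1 + e) * ((1 - k) * v - u) := by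
  by_contra! hcon
  set σ := scoreSD k e with hσ
  have hσ0 : 0 < σ := scoreSD_pos hk hk1 e
  have hσ2 := sq_scoreSD hk hk1 e
  rw [← hσ] at hσ2
  have hκ := sq_kappa hk hk1
  set κ := √(1 - k ^ 2) with hκdef
  set w := (1 - k) * v with hw
  have hw0 : 0 ≤ w := mul_nonneg (by linarith) hv
  rcases le_total w u with hwu | hwu
  -- The two signals cancel so much that the noiseless point is already a false negative, and the
  -- rate is zero.
  · have hmem : (0, 0) ∈ fnSet k e u v (-v) := by
      have h1 : v + k * -v + 0 = w := by rw [hw]; ring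
      have h2 : k * v + -v + k * 0 + κ * 0 = -w := by rw [hw]; ring
      simp only [fnSet, Set.mem_ofPred_eq, pairScore, score]
      rw [h1, ← hκdef, h2, soft_neg hu, soft_of_abs_le (by rwa [abs_of_nonneg hw0])]
      simpa [abs_of_nonneg hw0] using hwu
    have := rate_le hmem
    simp only [normSq₂] at this
    nlinarith
  -- The distance along the direction of steepest descent at which the score, with `soft` in its
  -- lower linear branch, falls to `u`.
  · set t := (1 + e) * (w - u) / σ with ht
    have ht0 : 0 ≤ t := div_nonneg (mul_nonneg (by linarith) (by linarith)) hσ0.le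
    have htd : t ≤ d := by rw [ht, div_le_iff₀ hσ0]; exact hcon
    have htσ : t * σ = (1 + e) * (w - u) := by rw [ht]; field_simp
    clear_value t
    have hz2 : k * (-(t * (1 - e * k)) / σ) + κ * (t * e * κ / σ) = -(t * (k - e) / σ) := by
      field_simp
      linear_combination (e * t) * hκ
    have hnn : 0 ≤ t * (k - e) / σ := div_nonneg (mul_nonneg ht0 (by linarith)) hσ0.le
    have hsum : t * (1 - e * k) / σ - e * (t * (k - e) / σ) = t * σ := by
      field_simp
      linear_combination (-t) * hσ2
    have hmem : (-(t * (1 - e * k)) / σ, t * e * κ / σ) ∈ fnSet k e u v (-v) := by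
      have h1 : v + k * -v + -(t * (1 - e * k)) / σ = w - t * (1 - e * k) / σ := by
        rw [hw]; ring
      have h2 : k * v + -v + k * (-(t * (1 - e * k)) / σ) + κ * (t * e * κ / σ) =
          -w - t * (k - e) / σ := by linear_combination hz2 + hw
      simp only [fnSet, Set.mem_ofPred_eq, pairScore, score]
      rw [h1, ← hκdef, h2, soft_of_le hu (by linarith)]
      have h3 : w - t * (1 - e * k) / σ - e * (-w - t * (k - e) / σ + u) = u := by
        linear_combination (-1) * hsum - htσ
      rw [h3, abs_of_nonneg hu]
    have hle := rate_le hmem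
    have hns : normSq₂ (-(t * (1 - e * k)) / σ, t * e * κ / σ) = t ^ 2 := by
      simp only [normSq₂]
      field_simp
      linear_combination t ^ 2 * (e ^ 2 * hκ - hσ2)
    nlinarith

end Necessary

/-! ### Sufficient conditions: discs that avoid the error sets -/

section Sufficient

variable {k e u v c d : ℝ}

lemma lt_rate_fpSet_zero (hk : 0 ≤ k) (hk1 : k < 1) (hu : 1 < u) :
    1 < rate (fpSet k e u 0) := by
  refine lt_rate (isClosed_fpSet ..)
    (fpSet_nonempty (by rwa [abs_of_nonneg hk]) ..) fun z hz hmem => ?_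
  rw [← one_pow 2] at hz
  have h1 := abs_fst_le zero_le_one hz
  have h2 := abs_second_le hk hk1 zero_le_one hz
  simp only [fpSet, Set.mem_ofPred_eq, pairScore, score, mul_zero, zero_add, add_zero] at hmem
  rw [soft_of_abs_le (by linarith)] at hmem
  simp only [mul_zero, sub_zero] at hmem
  linarith

/-- In the disc of radius `c` the partner statistic stays above `v - c > u`, so the score is affine
in the noise and fluctuates by at most `c * scoreSD k e`. -/
lemma lt_rate_fpSet (hk : 0 ≤ k) (hk1 : k < 1) (he : 0 ≤ e) (hek : e ≤ k) (hc : 0 ≤ c)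
    (hcu : c < u) (huv : u + c < v) (h : (k - e) * v + c * scoreSD k e < (1 - e) * u) :
    c ^ 2 < rate (fpSet k e u v) := by
  refine lt_rate (isClosed_fpSet ..)
    (fpSet_nonempty (by rwa [abs_of_nonneg hk]) ..) fun z hz hmem => ?_
  have h2 := abs_le.1 (abs_second_le hk hk1 hc hz)
  have h3 := abs_le.1 (abs_diff_le (e := e) hk hk1 hc hz)
  have hσ := scoreSD_le_one he hek
  simp only [fpSet, Set.mem_ofPred_eq] at hmem
  refine absurd hmem (not_le.2 ?_)
  simp only [pairScore, score]
  rw [soft_of_ge (by linarith) (by linarith), abs_lt]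
  have h4 : c * scoreSD k e ≤ c := mul_le_of_le_one_right hc hσ
  have h5 : 0 ≤ (k - e) * v := mul_nonneg (by linarith) (by linarith)
  have h6 : 0 ≤ e * u := mul_nonneg he (by linarith)
  constructor <;> linarith

/-- The partner statistic may fall in either branch of `soft u x ≤ max 0 (x - u)`: the zero branch
is handled by `u + c < v`, the linear one by the last hypothesis. -/
lemma lt_rate_fnSet_zero (hk : 0 ≤ k) (hk1 : k < 1) (he : 0 ≤ e) (hc : 0 ≤ c)
    (hu : 0 < u) (huv : u + c < v) (h : (1 - e) * u + c * scoreSD k e < v * (1 - e * k)) :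
    c ^ 2 < rate (fnSet k e u v 0) := by
  refine lt_rate (isClosed_fnSet ..)
    (fnSet_nonempty (by rwa [abs_of_nonneg hk]) hu.le ..) fun z hz hmem => ?_
  have h1 := abs_le.1 (abs_fst_le hc hz)
  have h3 := abs_le.1 (abs_diff_le (e := e) hk hk1 hc hz)
  simp only [fnSet, Set.mem_ofPred_eq] at hmem
  refine absurd hmem (not_le.2 (lt_of_lt_of_le ?_ (le_abs_self _)))
  simp only [pairScore, score]
  have h4 := mul_le_mul_of_nonneg_left
    (soft_le_max u (k * v + 0 + k * z.1 + √(1 - k ^ 2) * z.2)) he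
  rcases max_cases 0 (k * v + 0 + k * z.1 + √(1 - k ^ 2) * z.2 - u) with ⟨h5, -⟩ | ⟨h5, -⟩ <;>
  rw [h5] at h4 <;> linarith

/-- With nonnegative correlation a second signal only helps, so the conditions for a lone signal
suffice. -/
lemma lt_rate_fnSet_pos (hk : 0 ≤ k) (hk1 : k < 1) (he : 0 ≤ e) (hek : e ≤ k)
    (hd : 0 ≤ d) (hdc : d ≤ c) (hu : 0 < u) (huv : u + c < v)
    (h : (1 - e) * u + c * scoreSD k e < v * (1 - e * k)) :
    d ^ 2 < rate (fnSet k e u v v) := by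
  refine lt_rate (isClosed_fnSet ..)
    (fnSet_nonempty (by rwa [abs_of_nonneg hk]) hu.le ..) fun z hz hmem => ?_
  have h1 := abs_le.1 (abs_fst_le hd hz)
  have h3 := abs_le.1 (abs_diff_le (e := e) hk hk1 hd hz)
  simp only [fnSet, Set.mem_ofPred_eq] at hmem
  refine absurd hmem (not_le.2 (lt_of_lt_of_le ?_ (le_abs_self _)))
  simp only [pairScore, score]
  have h4 := mul_le_mul_of_nonneg_left
    (soft_le_max u (k * v + v + k * z.1 + √(1 - k ^ 2) * z.2)) he
  have h6 : d * scoreSD k e ≤ c * scoreSD k e :=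
    mul_le_mul_of_nonneg_right hdc (scoreSD_pos hk hk1 e).le
  have h7 : 0 ≤ (k - e) * v := mul_nonneg (by linarith) (by linarith)
  have h8 : 0 ≤ k * v := mul_nonneg hk (by linarith)
  rcases max_cases 0 (k * v + v + k * z.1 + √(1 - k ^ 2) * z.2 - u) with ⟨h5, -⟩ | ⟨h5, -⟩ <;>
  rw [h5] at h4 <;> linarith

/-- The bound `soft u x ≤ x + u` holds on every branch and is sharp on the relevant one, so no case
distinction is needed. -/
lemma lt_rate_fnSet_neg (hk : 0 ≤ k) (hk1 : k < 1) (he : 0 ≤ e) (hd : 0 ≤ d) (hu : 0 < u)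
    (h : d * scoreSD k e < (1 + e) * ((1 - k) * v - u)) :
    d ^ 2 < rate (fnSet k e u v (-v)) := by
  refine lt_rate (isClosed_fnSet ..)
    (fnSet_nonempty (by rwa [abs_of_nonneg hk]) hu.le ..) fun z hz hmem => ?_
  have h3 := abs_le.1 (abs_diff_le (e := e) hk hk1 hd hz)
  simp only [fnSet, Set.mem_ofPred_eq] at hmem
  refine absurd hmem (not_le.2 (lt_of_lt_of_le ?_ (le_abs_self _)))
  simp only [pairScore, score]
  have h4 := mul_le_mul_of_nonneg_left
    (soft_le_add u (k * v + -v + k * z.1 + √(1 - k ^ 2) * z.2)) he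
  linarith

end Sufficient

/-! ### Elimination of the threshold -/

/-- The explicit description of the signal strengths `v = √r` for which some threshold gives an
exponent larger than one, when the selection rule has correlation parameter of absolute value `e`. -/
def PhaseCond (ρ ϑ e v : ℝ) : Prop :=
  1 + √(1 - ϑ) < v ∧ √(1 - ϑ) * (scoreSD |ρ| e + 1 - e) < (1 - |ρ|) * v ∧
    (ρ < 0 → ϑ ≤ 1 / 2 →
      1 + √(1 - 2 * ϑ) * scoreSD |ρ| e / (1 + e) < (1 - |ρ|) * v ∧
      scoreSD |ρ| e * (√(1 - ϑ) + √(1 - 2 * ϑ) * (1 - e) / (1 + e)) <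
        v * (1 - 2 * |ρ| + |ρ| * e))

lemma one_lt_pairExponent_iff {ρ η ϑ u v : ℝ} (hϑ : ϑ ∈ Set.Ioo (0 : ℝ) 1) :
    1 < pairExponent ρ η ϑ u v ↔
      1 < rate (fpSet ρ η u 0) ∧ √(1 - ϑ) ^ 2 < rate (fpSet ρ η u v) ∧
        √(1 - ϑ) ^ 2 < rate (fnSet ρ η u v 0) ∧
          (ϑ ≤ 1 / 2 → √(1 - 2 * ϑ) ^ 2 < rate (fnSet ρ η u v v)) := by
  rw [Real.sq_sqrt (by linarith [hϑ.2]), pairExponent, lt_min_iff, lt_min_iff, lt_min_iff,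
    and_assoc]
  refine and_congr_right' (and_congr (sub_lt_iff_lt_add').symm
    (and_congr (sub_lt_iff_lt_add').symm ⟨fun h h' => ?_, fun h => ?_⟩))
  · rw [Real.sq_sqrt (by linarith)]; linarith
  -- For `ϑ > 1/2` two signals in one block are so rare that `2 * ϑ` alone exceeds one.
  · rcases le_or_gt ϑ (1 / 2) with h' | h'
    · have := h h'
      rw [Real.sq_sqrt (by linarith)] at this; linarith
    · linarith [rate_nonneg (fnSet ρ η u v v)]

lemma sqrt_one_sub_two_mul_le {ϑ : ℝ} (hϑ : 0 ≤ ϑ) : √(1 - 2 * ϑ) ≤ √(1 - ϑ) :=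
  Real.sqrt_le_sqrt (by linarith)

section

variable {k e u v c d : ℝ}

/-- The sufficient condition for false negatives in the linear branch adds the upper bound `v * (1 -
e * k) - c * σ` for `(1 - e) * u`. The first two conclusions show that it never conflicts with the
lower bounds, so it leaves no trace in `PhaseCond`. -/
lemma threshold_interval_bounds (he : 0 ≤ e) (he1 : e < 1) (hc : 0 ≤ c) {σ : ℝ}
    (hσ : σ ≤ 1) (h1 : 1 + c < v) (h2 : c * (σ + 1 - e) < (1 - k) * v) :
    (1 - e + c * σ < v * (1 - e * k)) ∧
      ((k - e) * v + c * σ < v * (1 - e * k) - c * σ) ∧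
      ((k - e) * v + c * σ < (1 - e) * (v - c)) := by
  refine ⟨?_, ?_, by linarith⟩
  · have h3 := mul_lt_mul_of_pos_left h1 (by linarith : 0 < 1 - e)
    have h4 := mul_le_mul_of_nonneg_left h2.le he
    have h5 : c * ((1 - e) * σ) ≤ c * ((1 - e) * (1 + e)) :=
      mul_le_mul_of_nonneg_left (mul_le_mul_of_nonneg_left (by linarith) (by linarith)) hc
    linarith
  · have h4 := mul_lt_mul_of_pos_left h2 (by linarith : 0 < 1 + e)
    have h5 : c * ((1 - e) * σ) ≤ c * ((1 - e) * (1 + e)) :=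
      mul_le_mul_of_nonneg_left (mul_le_mul_of_nonneg_left (by linarith) (by linarith)) hc
    linarith

/-- Finitely many strict lower and upper bounds are compatible once every lower bound is below every
upper bound. -/
lemma exists_level (he1 : e < 1) {A B C D : ℝ} (hC : 1 < C) (hD : 1 < D)
    (hB : 1 - e < B) (hAB : A < B) (hAC : A < (1 - e) * C) (hAD : A < (1 - e) * D) :
    ∃ u, 1 < u ∧ u < C ∧ u < D ∧ A < (1 - e) * u ∧ (1 - e) * u < B := by
  have h : 0 < 1 - e := by linarith
  obtain ⟨u, hu1, hu2⟩ := exists_between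
    (show max 1 (A / (1 - e)) < min C (min D (B / (1 - e))) from
      lt_min (max_lt hC (by rw [div_lt_iff₀ h]; linarith)) (lt_min
        (max_lt hD (by rw [div_lt_iff₀ h]; linarith)) (max_lt (by rw [lt_div_iff₀ h]; linarith)
        (div_lt_div_of_pos_right hAB h))))
  simp only [max_lt_iff, lt_min_iff, div_lt_iff₀ h, lt_div_iff₀ h] at hu1 hu2
  exact ⟨u, hu1.1, hu2.1, hu2.2.1, by linarith [hu1.2], by linarith [hu2.2.2]⟩

end

/-- The range of thresholds with exponent larger than one is nonempty exactly under `PhaseCond`. -/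
theorem exists_one_lt_pairExponent_iff {ρ ϑ s v : ℝ} (hρ : |ρ| < 1) (hϑ : ϑ ∈ Set.Ioo (0 : ℝ) 1)
    (hs : s ∈ Set.Icc (0 : ℝ) 1) (hv : 0 < v) :
    (∃ u, 0 < u ∧ 1 < pairExponent ρ (s * ρ) ϑ u v) ↔ PhaseCond ρ ϑ (s * |ρ|) v := by
  have hc0 : 0 ≤ √(1 - ϑ) := Real.sqrt_nonneg _
  have hd0 : 0 ≤ √(1 - 2 * ϑ) := Real.sqrt_nonneg _
  have hdc := sqrt_one_sub_two_mul_le hϑ.1.le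
  have hc1 : √(1 - ϑ) ≤ 1 := Real.sqrt_le_one.2 (by linarith [hϑ.1])
  have hk0 := abs_nonneg ρ
  have he0 : 0 ≤ s * |ρ| := mul_nonneg hs.1 hk0
  have hek : s * |ρ| ≤ |ρ| := mul_le_of_le_one_left hk0 hs.2
  have hσ := scoreSD_le_one he0 hek
  have hσ0 := scoreSD_pos hk0 hρ (s * |ρ|)
  simp only [one_lt_pairExponent_iff hϑ, PhaseCond]
  set c := √(1 - ϑ)
  set d := √(1 - 2 * ϑ)
  rcases le_or_gt 0 ρ with h0 | h0
  · rw [abs_of_nonneg h0] at *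
    set e := s * ρ
    constructor
    · rintro ⟨u, hu, h1, h2, h3, -⟩
      have hu1 : 1 < u := by
        have := h1.trans_le (rate_fpSet_zero_le (by rwa [abs_of_nonneg h0]) hu.le _)
        nlinarith
      have huv := add_lt_of_lt_rate_fnSet (by rwa [abs_of_nonneg h0]) hu.le hv.le hc0 h3
      have h4 := lt_of_lt_rate_fpSet h0 hρ hek hu.le (by linarith) hc0 h2
      refine ⟨by linarith, ?_, fun h => absurd h (by linarith)⟩
      have := mul_lt_mul_of_pos_left huv (by linarith : 0 < 1 - e)
      linarith
    · rintro ⟨h1, h2, -⟩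
      obtain ⟨hB, hAB, hAC⟩ := threshold_interval_bounds he0 (by linarith) hc0 hσ h1 h2
      -- For nonnegative correlation two signals impose no new upper bound on `u`, so `v - c` fills
      -- both slots.
      obtain ⟨u, hu1, huC, -, huA, huB⟩ := exists_level (by linarith : e < 1)
        (C := v - c) (D := v - c) (A := (ρ - e) * v + c * scoreSD ρ e)
        (B := v * (1 - e * ρ) - c * scoreSD ρ e)
        (by linarith) (by linarith) (by linarith) hAB hAC hAC
      exact ⟨u, by linarith, lt_rate_fpSet_zero h0 hρ hu1,
        lt_rate_fpSet h0 hρ he0 hek hc0 (by linarith) (by linarith) huA,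
        lt_rate_fnSet_zero h0 hρ he0 hc0 (by linarith) (by linarith) (by linarith),
        fun _ => lt_rate_fnSet_pos h0 hρ he0 hek hd0 hdc (by linarith) (by linarith)
          (by linarith)⟩
  · rw [abs_of_neg h0] at *
    obtain ⟨k, rfl⟩ : ∃ k, ρ = -k := ⟨-ρ, by ring⟩
    rw [neg_neg, mul_neg] at *
    set e := s * k
    constructor
    · rintro ⟨u, hu, h1, h2, h3, h5⟩
      rw [rate_fpSet_neg hu.le] at h1 h2
      rw [rate_fnSet_neg hu.le] at h3 h5
      rw [neg_zero] at h3
      have hu1 : 1 < u := by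
        have := h1.trans_le (rate_fpSet_zero_le (by rwa [abs_of_nonneg hk0]) hu.le _)
        nlinarith
      have huv := add_lt_of_lt_rate_fnSet (by rwa [abs_of_nonneg hk0]) hu.le hv.le hc0 h3
      have h4 := lt_of_lt_rate_fpSet hk0 hρ hek hu.le (by linarith) hc0 h2
      have h6 := mul_lt_mul_of_pos_left huv (by linarith : 0 < 1 - e)
      refine ⟨by linarith, by linarith, fun _ h => ?_⟩
      have h7 := lt_of_lt_rate_fnSet_neg hk0 hρ he0 hek hu.le hv.le hd0 (h5 h)
      have he' : 0 < 1 + e := by linarith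
      have h8 : d * scoreSD k e / (1 + e) < (1 - k) * v - u := by
        rw [div_lt_iff₀ he']; linarith
      refine ⟨by linarith, ?_⟩
      have h9 := mul_lt_mul_of_pos_left h8 (by linarith : 0 < 1 - e)
      have h10 : scoreSD k e * (c + d * (1 - e) / (1 + e)) =
        c * scoreSD k e + (1 - e) * (d * scoreSD k e / (1 + e)) := by ring
      rw [h10]
      linarith
    · rintro ⟨h1, h2, h3⟩
      obtain ⟨hB, hAB, hAC⟩ := threshold_interval_bounds he0 (by linarith) hc0 hσ h1 h2
      have he' : 0 < 1 + e := by linarith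
      obtain ⟨D, hD1, hAD, hD⟩ : ∃ D, 1 < D ∧ (k - e) * v + c * scoreSD k e < (1 - e) * D ∧
          (ϑ ≤ 1 / 2 → D = (1 - k) * v - d * scoreSD k e / (1 + e)) := by
        rcases le_or_gt ϑ (1 / 2) with h | h
        · obtain ⟨h4, h5⟩ := h3 h0 h
          refine ⟨_, by linarith, ?_, fun _ => rfl⟩
          have h10 : scoreSD k e * (c + d * (1 - e) / (1 + e)) =
            c * scoreSD k e + (1 - e) * (d * scoreSD k e / (1 + e)) := by ring
          rw [h10] at h5
          linarith
        · exact ⟨v - c, by linarith, hAC, fun h' => absurd h' (by linarith)⟩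
      obtain ⟨u, hu1, huC, huD, huA, huB⟩ := exists_level (by linarith : e < 1)
        (C := v - c) (A := (k - e) * v + c * scoreSD k e)
        (B := v * (1 - e * k) - c * scoreSD k e)
        (by linarith) hD1 (by linarith) hAB hAC hAD
      have hu0 : 0 ≤ u := by linarith
      refine ⟨u, by linarith, ?_⟩
      rw [rate_fpSet_neg hu0, rate_fpSet_neg hu0, rate_fnSet_neg hu0, rate_fnSet_neg hu0, neg_zero]
      refine ⟨lt_rate_fpSet_zero hk0 hρ hu1,
        lt_rate_fpSet hk0 hρ he0 hek hc0 (by linarith) (by linarith) huA,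
        lt_rate_fnSet_zero hk0 hρ he0 hc0 (by linarith) (by linarith) (by linarith),
        fun h => lt_rate_fnSet_neg hk0 hρ he0 hd0 (by linarith) ?_⟩
      rw [hD h] at huD
      have h8 : d * scoreSD k e / (1 + e) < (1 - k) * v - u := by linarith
      rw [div_lt_iff₀ he'] at h8
      linarith

/-! ### Monotonicity and stability of the explicit condition -/

section PhaseCond

variable {ρ ϑ e e' v v' : ℝ}

/-- The left sides decrease with `e`, because `scoreSD |ρ|` does on `[0, |ρ|]`; the right sides do
not decrease with `e` or `v`. -/
lemma PhaseCond.mono (hρ : |ρ| < 1) (he : 0 ≤ e) (hee' : e ≤ e') (he' : e' ≤ |ρ|) (hv : v ≤ v')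
    (h : PhaseCond ρ ϑ e v) : PhaseCond ρ ϑ e' v' := by
  have hc0 : 0 ≤ √(1 - ϑ) := Real.sqrt_nonneg _
  have hd0 : 0 ≤ √(1 - 2 * ϑ) := Real.sqrt_nonneg _
  have hσ := scoreSD_anti hee' he'
  have hσ0 := scoreSD_pos (abs_nonneg ρ) hρ e
  have hσ0' := scoreSD_pos (abs_nonneg ρ) hρ e'
  obtain ⟨h1, h2, h3⟩ := h
  have hv0 : 0 < v := by linarith
  have hkv : (1 - |ρ|) * v ≤ (1 - |ρ|) * v' := mul_le_mul_of_nonneg_left hv (by linarith)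
  refine ⟨by linarith, ?_, fun h0 ht => ?_⟩
  · have := mul_le_mul_of_nonneg_left
      (by linarith : scoreSD |ρ| e' + 1 - e' ≤ scoreSD |ρ| e + 1 - e) hc0
    linarith
  · obtain ⟨h4, h5⟩ := h3 h0 ht
    constructor
    · have : √(1 - 2 * ϑ) * scoreSD |ρ| e' / (1 + e') ≤ √(1 - 2 * ϑ) * scoreSD |ρ| e / (1 + e) := by
        gcongr
      linarith
    · have h6 : √(1 - ϑ) + √(1 - 2 * ϑ) * (1 - e') / (1 + e') ≤
          √(1 - ϑ) + √(1 - 2 * ϑ) * (1 - e) / (1 + e) := by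
        have h1 : 0 ≤ √(1 - 2 * ϑ) * (1 - e) := mul_nonneg hd0 (by linarith)
        gcongr
      have h7 : 0 ≤ √(1 - ϑ) + √(1 - 2 * ϑ) * (1 - e') / (1 + e') :=
        add_nonneg hc0 (div_nonneg (mul_nonneg hd0 (by linarith)) (by linarith))
      have h8 : scoreSD |ρ| e' * (√(1 - ϑ) + √(1 - 2 * ϑ) * (1 - e') / (1 + e')) ≤
          scoreSD |ρ| e * (√(1 - ϑ) + √(1 - 2 * ϑ) * (1 - e) / (1 + e)) := by
        gcongr
      -- The factor `1 - 2|ρ| + |ρ| e` can be negative in general; the inequality itself forces it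
      -- to be positive, so raising `v` helps.
      have h9 : 0 < v * (1 - 2 * |ρ| + |ρ| * e) :=
        lt_of_le_of_lt ((mul_nonneg hσ0'.le h7).trans h8) h5
      have h10 : 0 < 1 - 2 * |ρ| + |ρ| * e := pos_of_mul_pos_right h9 hv0.le
      have h11 : |ρ| * e ≤ |ρ| * e' := mul_le_mul_of_nonneg_left hee' (abs_nonneg ρ)
      have h12 : v * (1 - 2 * |ρ| + |ρ| * e) ≤ v' * (1 - 2 * |ρ| + |ρ| * e') := by
        have := hv0.le.trans hv
        gcongr
      linarith

lemma continuousAt_phase_quotient (he : 0 ≤ e) :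
    ContinuousAt (fun e => √(1 - 2 * ϑ) * scoreSD |ρ| e / (1 + e)) e ∧
      ContinuousAt (fun e => scoreSD |ρ| e * (√(1 - ϑ) + √(1 - 2 * ϑ) * (1 - e) / (1 + e))) e := by
  have h : 1 + e ≠ 0 := by positivity
  constructor
  · exact ContinuousAt.div (by fun_prop) (by fun_prop) h
  · exact ContinuousAt.mul (by fun_prop)
      (continuousAt_const.add (ContinuousAt.div (by fun_prop) (by fun_prop) h))

lemma PhaseCond.eventually (he : 0 ≤ e) (h : PhaseCond ρ ϑ e v) :
    ∀ᶠ x in 𝓝 e, PhaseCond ρ ϑ x v := by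
  obtain ⟨h1, h2, h3⟩ := h
  obtain ⟨hc1, hc2⟩ := continuousAt_phase_quotient (ρ := ρ) (ϑ := ϑ) he
  have e2 : ∀ᶠ x in 𝓝 e, √(1 - ϑ) * (scoreSD |ρ| x + 1 - x) < (1 - |ρ|) * v :=
    ContinuousAt.eventually_lt (by fun_prop) continuousAt_const h2
  by_cases h0 : ρ < 0 ∧ ϑ ≤ 1 / 2
  · obtain ⟨h4, h5⟩ := h3 h0.1 h0.2
    have e4 := (continuousAt_const.add hc1).eventually_lt continuousAt_const h4
    have e5 := hc2.eventually_lt (g := fun x => v * (1 - 2 * |ρ| + |ρ| * x)) (by fun_prop) h5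
    filter_upwards [e2, e4, e5] with x a b c
    exact ⟨h1, a, fun _ _ => ⟨b, c⟩⟩
  · filter_upwards [e2] with x a
    exact ⟨h1, a, fun h h' => absurd ⟨h, h'⟩ h0⟩

/-- In the limit the inequalities become weak; the passage from `v` to `v'` makes them strict again.
-/
lemma PhaseCond.of_frequently (hρ : |ρ| < 1) (hϑ : ϑ < 1) (he : 0 ≤ e) (he1 : e ≤ |ρ|)
    (hv : 0 < v) (hvv' : v < v')
    (h : ∃ᶠ x in 𝓝 e, PhaseCond ρ ϑ x v) : PhaseCond ρ ϑ e v' := by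
  obtain ⟨hc1, hc2⟩ := continuousAt_phase_quotient (ρ := ρ) (ϑ := ϑ) he
  have hkv : (1 - |ρ|) * v < (1 - |ρ|) * v' := mul_lt_mul_of_pos_left hvv' (by linarith)
  have closed : ∀ {f g : ℝ → ℝ}, ContinuousAt f e → ContinuousAt g e →
      (∃ᶠ x in 𝓝 e, f x < g x) → f e ≤ g e := by
    intro f g hf hg hfg
    by_contra! hlt
    exact hfg ((hg.eventually_lt hf hlt).mono fun x hx => not_lt.2 hx.le)
  obtain ⟨_, hx, -⟩ := h.exists
  refine ⟨by linarith, ?_, fun h0 ht => ?_⟩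
  · have := closed (f := fun x => √(1 - ϑ) * (scoreSD |ρ| x + 1 - x)) (g := fun _ => (1 - |ρ|) * v)
      (by fun_prop) (by fun_prop) (h.mono fun x hx => hx.2.1)
    linarith
  · have h4 := closed (f := fun x => 1 + √(1 - 2 * ϑ) * scoreSD |ρ| x / (1 + x))
      (continuousAt_const.add hc1) continuousAt_const
      (h.mono fun x hx => (hx.2.2 h0 ht).1)
    have h5 := closed hc2 (g := fun x => v * (1 - 2 * |ρ| + |ρ| * x)) (by fun_prop)
      (h.mono fun x hx => (hx.2.2 h0 ht).2)
    refine ⟨by linarith, ?_⟩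
    -- Strict positivity, from `ϑ < 1`, forces a positive coefficient of `v`, without which
    -- increasing `v` would give no slack.
    have h6 : 0 < scoreSD |ρ| e * (√(1 - ϑ) + √(1 - 2 * ϑ) * (1 - e) / (1 + e)) :=
      mul_pos (scoreSD_pos (abs_nonneg ρ) hρ e) (add_pos_of_pos_of_nonneg
        (Real.sqrt_pos.2 (by linarith))
        (div_nonneg (mul_nonneg (Real.sqrt_nonneg _) (by linarith)) (by linarith)))
    have h7 : 0 < 1 - 2 * |ρ| + |ρ| * e := pos_of_mul_pos_right (h6.trans_le h5) hv.le
    exact h5.trans_lt (mul_lt_mul_of_pos_right hvv' h7)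

lemma not_phaseCond_zero (hρ : |ρ| < 1) (hρ' : ρ ≤ -(1 / 2)) (hϑ : ϑ ≤ 1 / 2) (v : ℝ)
    (hv : 0 ≤ v) : ¬ PhaseCond ρ ϑ 0 v := by
  rintro ⟨-, -, h⟩
  have h1 := (h (by linarith) hϑ).2
  have h2 := scoreSD_pos (abs_nonneg ρ) hρ 0
  have h3 : 0 ≤ scoreSD |ρ| 0 * (√(1 - ϑ) + √(1 - 2 * ϑ) * (1 - 0) / (1 + 0)) := by
    simp only [sub_zero, add_zero, mul_one, div_one]; positivity
  rw [abs_of_neg (by linarith)] at *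
  nlinarith

end PhaseCond

/-! ### Continuity of the explicit phase curve -/

/-- The upper phase curve in terms of the explicit condition. -/
def phaseCurve (ρ ϑ e : ℝ) : ℝ≥0∞ :=
  ⨅ (r : ℝ) (_ : 0 < r) (_ : PhaseCond ρ ϑ e √r), ENNReal.ofReal r

section PhaseCurve

variable {ρ ϑ e e' : ℝ}

lemma phaseCurve_le {r : ℝ} (hr : 0 < r) (h : PhaseCond ρ ϑ e √r) :
    phaseCurve ρ ϑ e ≤ ENNReal.ofReal r := iInf₂_le_of_le r hr (iInf_le _ h)

lemma le_phaseCurve {a : ℝ≥0∞} (h : ∀ r, 0 < r → PhaseCond ρ ϑ e √r → a ≤ ENNReal.ofReal r) :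
    a ≤ phaseCurve ρ ϑ e := le_iInf₂ fun r hr => le_iInf (h r hr)

lemma phaseCurve_anti (hρ : |ρ| < 1) (he : 0 ≤ e) (hee' : e ≤ e') (he' : e' ≤ |ρ|) :
    phaseCurve ρ ϑ e' ≤ phaseCurve ρ ϑ e :=
  le_phaseCurve fun _ hr h => phaseCurve_le hr (h.mono hρ he hee' he' le_rfl)

lemma eventually_phaseCurve_lt (he : 0 ≤ e) {b : ℝ≥0∞} (hb : phaseCurve ρ ϑ e < b) :
    ∀ᶠ x in 𝓝 e, phaseCurve ρ ϑ x < b := by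
  simp only [phaseCurve, iInf_lt_iff] at hb
  obtain ⟨r, hr, h, hlt⟩ := hb
  exact (h.eventually he).mono fun x hx => (phaseCurve_le hr hx).trans_lt hlt

/-- Lower semicontinuity: choose `r₁ < r₂` between `a` and the curve. Failure at `r₂` excludes the
condition at `r₁` for all nearby parameters, and monotonicity in the signal strength excludes all
smaller `r`. -/
lemma eventually_lt_phaseCurve (hρ : |ρ| < 1) (hϑ : ϑ < 1) (he : 0 ≤ e) (he1 : e ≤ |ρ|)
    {a : ℝ≥0∞} (ha : a < phaseCurve ρ ϑ e) :
    ∀ᶠ x in 𝓝 e, 0 ≤ x → x ≤ |ρ| → a < phaseCurve ρ ϑ x := by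
  obtain ⟨r₁, ha1, h1⟩ := ENNReal.lt_iff_exists_nnreal_btwn.1 ha
  obtain ⟨r₂, h12, h2⟩ := ENNReal.lt_iff_exists_nnreal_btwn.1 h1
  have hr1 : 0 < (r₁ : ℝ) := by
    have := pos_of_gt ha1
    exact_mod_cast this
  have hr12 : (r₁ : ℝ) < r₂ := by exact_mod_cast h12
  have hnot : ¬ PhaseCond ρ ϑ e √r₂ := fun h => by
    have := phaseCurve_le (hr1.trans hr12) h
    rw [ENNReal.ofReal_coe_nnreal] at this
    exact absurd h2 (not_lt.2 this)
  have hev : ∀ᶠ x in 𝓝 e, ¬ PhaseCond ρ ϑ x √r₁ := by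
    by_contra hcon
    exact hnot (PhaseCond.of_frequently hρ hϑ he he1 (Real.sqrt_pos.2 hr1)
      (Real.sqrt_lt_sqrt hr1.le hr12) ((Filter.not_eventually.1 hcon).mono fun _ => not_not.1))
  filter_upwards [hev] with x hx hx0 hx1
  refine ha1.trans_le (le_phaseCurve fun r hr h => ?_)
  by_contra! hlt
  rw [← ENNReal.ofReal_coe_nnreal, ENNReal.ofReal_lt_ofReal_iff hr1] at hlt
  exact hx (h.mono hρ hx0 le_rfl hx1 (Real.sqrt_le_sqrt hlt.le))

lemma continuousWithinAt_phaseCurve (hρ : |ρ| < 1) (hϑ : ϑ < 1) (he : 0 ≤ e) (he1 : e ≤ |ρ|) :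
    ContinuousWithinAt (phaseCurve ρ ϑ) (Set.Icc 0 |ρ|) e := by
  refine tendsto_order.2 ⟨fun a ha => ?_, fun b hb => ?_⟩
  · filter_upwards [nhdsWithin_le_nhds (eventually_lt_phaseCurve hρ hϑ he he1 ha),
      self_mem_nhdsWithin] with x hx hx'
    exact hx hx'.1 hx'.2
  · exact nhdsWithin_le_nhds (eventually_phaseCurve_lt he hb)

lemma phaseCurve_zero_eq_top (hρ : |ρ| < 1) (hρ' : ρ ≤ -(1 / 2)) (hϑ : ϑ ≤ 1 / 2) :
    phaseCurve ρ ϑ 0 = ⊤ :=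
  top_le_iff.1 (le_phaseCurve fun _ _ h =>
    absurd h (not_phaseCond_zero hρ hρ' hϑ _ (Real.sqrt_nonneg _)))

lemma monotoneOn_phaseCurve_div (hρ : |ρ| < 1) :
    MonotoneOn (fun μ : ℝ => phaseCurve ρ ϑ ((1 + μ)⁻¹ * |ρ|)) (Set.Ioi 0) := by
  intro μ hμ μ' hμ' h
  simp only [Set.mem_Ioi] at hμ hμ'
  refine phaseCurve_anti hρ (by positivity) (by gcongr) ?_
  exact mul_le_of_le_one_left (abs_nonneg ρ) (inv_le_one_of_one_le₀ (by linarith))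

lemma tendsto_phaseCurve_div (hρ : |ρ| < 1) (hϑ : ϑ < 1) {l : Filter ℝ} {s : ℝ}
    (hs : s ∈ Set.Icc (0 : ℝ) 1) (hl : ∀ᶠ μ in l, 0 < μ)
    (h : Tendsto (fun μ : ℝ => (1 + μ)⁻¹) l (𝓝 s)) :
    Tendsto (fun μ : ℝ => phaseCurve ρ ϑ ((1 + μ)⁻¹ * |ρ|)) l (𝓝 (phaseCurve ρ ϑ (s * |ρ|))) := by
  have h0 := abs_nonneg ρ
  refine (continuousWithinAt_phaseCurve hρ hϑ (mul_nonneg hs.1 h0)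
    (mul_le_of_le_one_left h0 hs.2)).tendsto.comp
    (tendsto_nhdsWithin_iff.2 ⟨h.mul_const _, ?_⟩)
  filter_upwards [hl] with μ hμ
  exact ⟨by positivity, mul_le_of_le_one_left h0 (inv_le_one_of_one_le₀ (by linarith))⟩

end PhaseCurve

/-! ### Calculus of polynomial orders up to `p ^ o(1)` -/

section HasOrder

/-- The sequence `f p` is `p ^ (-a)` up to factors `p ^ o(1)`. -/
def HasOrder (f : ℕ → ℝ) (a : ℝ) : Prop :=
  ∀ ε : ℝ, 0 < ε → ∀ᶠ p : ℕ in atTop, (p : ℝ) ^ (-a - ε) ≤ f p ∧ f p ≤ (p : ℝ) ^ (-a + ε)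

lemma eventually_le_natCast_rpow (C : ℝ) {ε : ℝ} (hε : 0 < ε) :
    ∀ᶠ p : ℕ in atTop, C ≤ (p : ℝ) ^ ε :=
  ((tendsto_rpow_atTop hε).comp tendsto_natCast_atTop_atTop).eventually_ge_atTop C

variable {f g : ℕ → ℝ} {a b : ℝ}

lemma HasOrder.of_le_mul {C c : ℝ} (hc : 0 < c) (hf : HasOrder f a)
    (h1 : ∀ᶠ p in atTop, c * f p ≤ g p) (h2 : ∀ᶠ p in atTop, g p ≤ C * f p) : HasOrder g a := by
  intro ε hε
  filter_upwards [hf (ε / 2) (by linarith), h1, h2, eventually_le_natCast_rpow C (half_pos hε),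
    eventually_le_natCast_rpow c⁻¹ (half_pos hε), eventually_gt_atTop 0] with p hp h1 h2 h3 h4 hp0
  have hp0 : (0 : ℝ) < p := by exact_mod_cast hp0
  have e1 : (p : ℝ) ^ (-a - ε / 2) = p ^ (-a - ε) * p ^ (ε / 2) := by
    rw [← Real.rpow_add hp0]; congr 1; ring
  have e2 : (p : ℝ) ^ (-a + ε) = p ^ (ε / 2) * p ^ (-a + ε / 2) := by
    rw [← Real.rpow_add hp0]; congr 1; ring
  constructor
  · refine le_trans ?_ h1
    rw [e1] at hp
    have h5 : 1 ≤ c * (p : ℝ) ^ (ε / 2) := by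
      rwa [inv_le_iff_one_le_mul₀' hc] at h4
    calc (p : ℝ) ^ (-a - ε) ≤ p ^ (-a - ε) * (c * p ^ (ε / 2)) :=
          le_mul_of_one_le_right (by positivity) h5
      _ = c * (p ^ (-a - ε) * p ^ (ε / 2)) := by ring
      _ ≤ c * f p := mul_le_mul_of_nonneg_left hp.1 hc.le
  · refine h2.trans ?_
    rw [e2]
    have : 0 ≤ f p := le_trans (by positivity) hp.1
    exact mul_le_mul h3 hp.2 this (by positivity)

lemma HasOrder.mul (hf : HasOrder f a) (hg : HasOrder g b) :
    HasOrder (fun p => f p * g p) (a + b) := by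
  intro ε hε
  filter_upwards [hf (ε / 2) (by linarith), hg (ε / 2) (by linarith), eventually_gt_atTop 0]
    with p hp hp' hp0
  have hp0 : (0 : ℝ) < p := by exact_mod_cast hp0
  have e1 : (p : ℝ) ^ (-(a + b) - ε) = p ^ (-a - ε / 2) * p ^ (-b - ε / 2) := by
    rw [← Real.rpow_add hp0]; congr 1; ring
  have e2 : (p : ℝ) ^ (-(a + b) + ε) = p ^ (-a + ε / 2) * p ^ (-b + ε / 2) := by
    rw [← Real.rpow_add hp0]; congr 1; ring
  rw [e1, e2]
  have hf0 : 0 ≤ f p := le_trans (by positivity) hp.1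
  have hg0 : 0 ≤ g p := le_trans (by positivity) hp'.1
  exact ⟨mul_le_mul hp.1 hp'.1 (by positivity) hf0, mul_le_mul hp.2 hp'.2 hg0 (by positivity)⟩

lemma HasOrder.add (hf : HasOrder f a) (hg : HasOrder g b) :
    HasOrder (fun p => f p + g p) (min a b) := by
  intro ε hε
  filter_upwards [hf (ε / 2) (by linarith), hg (ε / 2) (by linarith), eventually_gt_atTop 0,
    eventually_le_natCast_rpow 2 (half_pos hε), hf ε hε, hg ε hε] with p h1 h2 hp0 h3 h4 h5
  have hp1 : (1 : ℝ) ≤ p := by exact_mod_cast hp0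
  have hp0 : (0 : ℝ) < p := by exact_mod_cast hp0
  have hf0 : 0 ≤ f p := le_trans (by positivity) h1.1
  have hg0 : 0 ≤ g p := le_trans (by positivity) h2.1
  constructor
  · rcases min_choice a b with h | h <;> rw [h] <;> linarith
  · have e1 : (p : ℝ) ^ (-a + ε / 2) ≤ p ^ (-min a b + ε / 2) :=
      Real.rpow_le_rpow_of_exponent_le hp1 (by linarith [min_le_left a b])
    have e2 : (p : ℝ) ^ (-b + ε / 2) ≤ p ^ (-min a b + ε / 2) :=
      Real.rpow_le_rpow_of_exponent_le hp1 (by linarith [min_le_right a b])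
    have e3 : (p : ℝ) ^ (-min a b + ε) = p ^ (ε / 2) * p ^ (-min a b + ε / 2) := by
      rw [← Real.rpow_add hp0]; congr 1; ring
    rw [e3]
    have := mul_le_mul_of_nonneg_right h3 (by positivity : 0 ≤ (p : ℝ) ^ (-min a b + ε / 2))
    linarith [h1.2, h2.2]

lemma hasOrder_rpow (a : ℝ) : HasOrder (fun p => (p : ℝ) ^ (-a)) a := by
  intro ε hε
  filter_upwards [eventually_gt_atTop 0] with p hp
  have hp1 : (1 : ℝ) ≤ p := by exact_mod_cast hp
  exact ⟨Real.rpow_le_rpow_of_exponent_le hp1 (by linarith),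
    Real.rpow_le_rpow_of_exponent_le hp1 (by linarith)⟩

lemma hasOrder_one_sub {ϑ : ℝ} (hϑ : 0 < ϑ) : HasOrder (fun p => 1 - (p : ℝ) ^ (-ϑ)) 0 := by
  have h1 : HasOrder (fun _ => (1 : ℝ)) 0 := by simpa using hasOrder_rpow 0
  refine h1.of_le_mul (C := 1) (one_half_pos (α := ℝ)) ?_ (Eventually.of_forall fun p => ?_)
  · filter_upwards [eventually_le_natCast_rpow 2 hϑ, eventually_gt_atTop 0] with p hp hp0
    have : (p : ℝ) ^ (-ϑ) ≤ 1 / 2 := by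
      rw [Real.rpow_neg (by positivity), one_div]
      exact inv_anti₀ two_pos hp
    linarith
  · have : 0 ≤ (p : ℝ) ^ (-ϑ) := by positivity
    linarith

lemma HasOrder.congr (hf : HasOrder f a) (h : f =ᶠ[atTop] g) : HasOrder g a := by
  intro ε hε
  filter_upwards [hf ε hε, h] with p hp h'
  rwa [← h']

lemma HasOrder.unique (hf : HasOrder f a) (hf' : HasOrder f b) : a = b := by
  suffices h : ∀ {a b}, HasOrder f a → HasOrder f b → a ≤ b from
    le_antisymm (h hf hf') (h hf' hf)
  intro a b hf hf'
  by_contra! hlt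
  obtain ⟨p, h1, h2, h3⟩ := ((hf ((a - b) / 3) (by linarith)).and
    ((hf' ((a - b) / 3) (by linarith)).and (eventually_gt_atTop 1))).exists
  have h4 : (p : ℝ) ^ (-b - (a - b) / 3) ≤ p ^ (-a + (a - b) / 3) := h2.1.trans h1.2
  rw [Real.rpow_le_rpow_left_iff (by exact_mod_cast h3)] at h4
  linarith

lemma isHammingExponent_iff {H : ℕ → ℝ} {h : ℝ} : IsHammingExponent H h ↔ HasOrder H (h - 1) := by
  constructor
  · rintro ⟨L, hL, hH⟩ ε hε
    obtain ⟨h1, h2⟩ := hL ε hε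
    filter_upwards [hH, h1.eventually_ge_atTop 1, h2.eventually_le_const one_pos,
      eventually_gt_atTop 0] with p hp h1 h2 hp0
    have hp0 : (0 : ℝ) < p := by exact_mod_cast hp0
    rw [hp]
    have e1 : (p : ℝ) ^ (-(h - 1) - ε) * p ^ ε = p ^ (1 - h) := by
      rw [← Real.rpow_add hp0]; congr 1; ring
    have e2 : (p : ℝ) ^ (-(h - 1) + ε) * p ^ (-ε) = p ^ (1 - h) := by
      rw [← Real.rpow_add hp0]; congr 1; ring
    constructor
    · calc (p : ℝ) ^ (-(h - 1) - ε) ≤ (L p * p ^ ε) * p ^ (-(h - 1) - ε) :=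
            le_mul_of_one_le_left (by positivity) h1
        _ = L p * p ^ (1 - h) := by rw [← e1]; ring
    · calc L p * p ^ (1 - h) = (L p * p ^ (-ε)) * p ^ (-(h - 1) + ε) := by rw [← e2]; ring
        _ ≤ 1 * p ^ (-(h - 1) + ε) := mul_le_mul_of_nonneg_right h2 (by positivity)
        _ = _ := one_mul _
  · intro hH
    refine ⟨fun p => H p * (p : ℝ) ^ (h - 1), fun ε hε => ⟨?_, ?_⟩, ?_⟩
    · refine tendsto_atTop_mono' _ ?_
        ((tendsto_rpow_atTop (half_pos hε)).comp tendsto_natCast_atTop_atTop)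
      filter_upwards [hH (ε / 2) (half_pos hε), eventually_gt_atTop 0] with p hp hp0
      have hp0 : (0 : ℝ) < p := by exact_mod_cast hp0
      calc (p : ℝ) ^ (ε / 2) = p ^ (-(h - 1) - ε / 2) * p ^ (h - 1) * p ^ ε := by
            rw [← Real.rpow_add hp0, ← Real.rpow_add hp0]; congr 1; ring
        _ ≤ _ := by
            have := hp.1
            gcongr
    · refine squeeze_zero' ?_ ?_
        ((tendsto_rpow_neg_atTop (half_pos hε)).comp tendsto_natCast_atTop_atTop)
      · filter_upwards [hH 1 one_pos] with p hp
        have : 0 ≤ H p := le_trans (by positivity) hp.1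
        positivity
      · filter_upwards [hH (ε / 2) (half_pos hε), eventually_gt_atTop 0] with p hp hp0
        have hp0 : (0 : ℝ) < p := by exact_mod_cast hp0
        calc _ ≤ (p : ℝ) ^ (-(h - 1) + ε / 2) * p ^ (h - 1) * p ^ (-ε) := by
              have := hp.2
              gcongr
          _ = (p : ℝ) ^ (-(ε / 2)) := by
            rw [← Real.rpow_add hp0, ← Real.rpow_add hp0]; congr 1; ring
    · filter_upwards [eventually_gt_atTop 0] with p hp0
      have hp0 : (0 : ℝ) < p := by exact_mod_cast hp0
      rw [mul_assoc, ← Real.rpow_add hp0]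
      simp

end HasOrder

/-! ### Gaussian large deviations in the plane -/

section Gaussian

/-- The standard Gaussian law on the plane. -/
def gauss₂ : Measure (ℝ × ℝ) := (gaussianReal 0 1).prod (gaussianReal 0 1)

instance : IsProbabilityMeasure gauss₂ := by unfold gauss₂; infer_instance

/-- The scale `√(2 log p)`. -/
def scale (p : ℕ) : ℝ := √(2 * Real.log p)

lemma scale_sq {p : ℕ} (hp : 1 ≤ p) : scale p ^ 2 = 2 * Real.log p :=
  Real.sq_sqrt (mul_nonneg two_pos.le (Real.log_nonneg (by exact_mod_cast hp)))

lemma scale_pos {p : ℕ} (hp : 1 < p) : 0 < scale p :=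
  Real.sqrt_pos.2 (mul_pos two_pos (Real.log_pos (by exact_mod_cast hp)))

lemma tendsto_scale : Tendsto scale atTop atTop :=
  Real.tendsto_sqrt_atTop.comp
    ((Real.tendsto_log_atTop.comp tendsto_natCast_atTop_atTop).const_mul_atTop two_pos)

lemma exp_scale {p : ℕ} (hp : 1 ≤ p) (a : ℝ) : Real.exp (-(scale p ^ 2 * a / 2)) = (p : ℝ) ^ (-a) := by
  rw [scale_sq hp, Real.rpow_def_of_pos (by exact_mod_cast hp)]
  congr 1; ring

lemma lintegral_exp_sq_lt_top {s : ℝ} (hs : s < 1) :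
    ∫⁻ x, ENNReal.ofReal (Real.exp (s * x ^ 2 / 2)) ∂gaussianReal 0 1 < ∞ := by
  rw [gaussianReal_of_var_ne_zero 0 one_ne_zero, lintegral_withDensity_eq_lintegral_mul _
    (measurable_gaussianPDF _ _) (by fun_prop)]
  have hint : Integrable fun x : ℝ => (√(2 * Real.pi))⁻¹ * Real.exp (-((1 - s) / 2) * x ^ 2) :=
    (integrable_exp_neg_mul_sq (by linarith)).const_mul _
  refine lt_of_le_of_lt (lintegral_mono fun x => ?_) hint.lintegral_lt_top
  simp only [Pi.mul_apply, gaussianPDF, gaussianPDFReal]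
  rw [← ENNReal.ofReal_mul (by positivity)]
  refine ENNReal.ofReal_le_ofReal (le_of_eq ?_)
  rw [mul_assoc, ← Real.exp_add]
  simp only [NNReal.coe_one, mul_one, sub_zero]
  congr 2; ring

/-- Markov's inequality for `exp (s |z|² / 2)`, whose Gaussian mean is finite because `s < 1`. -/
lemma gauss₂_tail {s : ℝ} (hs0 : 0 ≤ s) (hs : s < 1) :
    ∃ C : ℝ, ∀ t : ℝ, gauss₂.real {z | t ≤ normSq₂ z} ≤ C * Real.exp (-(s * t / 2)) := by
  set I := ∫⁻ x, ENNReal.ofReal (Real.exp (s * x ^ 2 / 2)) ∂gaussianReal 0 1 with hI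
  have hI' : I < ∞ := lintegral_exp_sq_lt_top hs
  refine ⟨(I * I).toReal, fun t => ?_⟩
  have hprod : ∫⁻ z, ENNReal.ofReal (Real.exp (s * normSq₂ z / 2)) ∂gauss₂ = I * I := by
    rw [hI, gauss₂, ← lintegral_prod_mul (by fun_prop) (by fun_prop)]
    refine lintegral_congr fun z => ?_
    rw [← ENNReal.ofReal_mul (by positivity), ← Real.exp_add]
    congr 2; unfold normSq₂; ring
  have hpos : ENNReal.ofReal (Real.exp (s * t / 2)) ≠ 0 := by
    simpa using Real.exp_pos _
  have h1 : gauss₂ {z | t ≤ normSq₂ z} ≤ I * I / ENNReal.ofReal (Real.exp (s * t / 2)) := by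
    rw [← hprod]
    refine le_trans (measure_mono fun z hz => ?_)
      (meas_ge_le_lintegral_div (by fun_prop) hpos ENNReal.ofReal_ne_top)
    have hz : t ≤ normSq₂ z := hz
    exact ENNReal.ofReal_le_ofReal (Real.exp_le_exp.2 (by nlinarith))
  have h2 := ENNReal.toReal_mono
    (ENNReal.div_ne_top (ENNReal.mul_ne_top hI'.ne hI'.ne) hpos) h1
  rw [ENNReal.toReal_div, ENNReal.toReal_ofReal (Real.exp_pos _).le] at h2
  rwa [Real.exp_neg, ← div_eq_mul_inv]

/-- The length of the interval times a lower bound for the density on it. -/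
lemma le_gaussianReal_Icc {T x δ : ℝ} (hT : 0 < T) :
    T * (2 * δ / √(2 * Real.pi)) * Real.exp (-(T ^ 2 * (|x| + δ) ^ 2 / 2)) ≤
      (gaussianReal 0 1).real (Set.Icc (T * (x - δ)) (T * (x + δ))) := by
  rw [Measure.real, gaussianReal_apply _ one_ne_zero]
  rw [← ENNReal.ofReal_le_iff_le_toReal]
  swap
  · rw [← gaussianReal_apply _ one_ne_zero]; exact measure_ne_top _ _
  calc ENNReal.ofReal (T * (2 * δ / √(2 * Real.pi)) * Real.exp (-(T ^ 2 * (|x| + δ) ^ 2 / 2)))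
      = ENNReal.ofReal ((√(2 * Real.pi))⁻¹ * Real.exp (-(T ^ 2 * (|x| + δ) ^ 2 / 2))) *
          volume (Set.Icc (T * (x - δ)) (T * (x + δ))) := by
        rw [Real.volume_Icc, ← ENNReal.ofReal_mul (by positivity)]
        congr 1; ring
    _ = ∫⁻ _ in Set.Icc (T * (x - δ)) (T * (x + δ)), ENNReal.ofReal
          ((√(2 * Real.pi))⁻¹ * Real.exp (-(T ^ 2 * (|x| + δ) ^ 2 / 2))) := by
        rw [setLIntegral_const]
    _ ≤ _ := by
        refine setLIntegral_mono' measurableSet_Icc fun y hy => ENNReal.ofReal_le_ofReal ?_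
        simp only [gaussianPDFReal, NNReal.coe_one, mul_one, sub_zero]
        refine mul_le_mul_of_nonneg_left (Real.exp_le_exp.2 ?_) (by positivity)
        have hy' : |y| ≤ T * (|x| + δ) := by
          rw [abs_le]
          have h1 := mul_le_mul_of_nonneg_left (neg_abs_le x) hT.le
          have h2 := mul_le_mul_of_nonneg_left (le_abs_self x) hT.le
          constructor <;> linarith [hy.1, hy.2]
        have := pow_le_pow_left₀ (abs_nonneg y) hy' 2
        rw [sq_abs] at this
        linarith

lemma gauss₂_upper {A : Set (ℝ × ℝ)} {a : ℝ} (ha : 0 ≤ a) (hA : ∀ z ∈ A, a ≤ normSq₂ z) {ε : ℝ}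
    (hε : 0 < ε) :
    ∀ᶠ p : ℕ in atTop, gauss₂.real ((fun z => (scale p)⁻¹ • z) ⁻¹' A) ≤ (p : ℝ) ^ (-a + ε) := by
  -- The Chernoff parameter is taken close enough to `1` to lose at most `ε / 2`; the `a + 1` in the
  -- denominator covers `a = 0`.
  obtain ⟨s, hs0, hs1, hsa⟩ : ∃ s : ℝ, 0 ≤ s ∧ s < 1 ∧ a - ε / 2 ≤ s * a := by
    refine ⟨max 0 (1 - ε / (2 * (a + 1))), le_max_left _ _, max_lt one_pos ?_, ?_⟩
    · have : 0 < ε / (2 * (a + 1)) := by positivity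
      linarith
    · refine le_trans ?_ (mul_le_mul_of_nonneg_right (le_max_right _ _) ha)
      have : ε / (2 * (a + 1)) * a ≤ ε / 2 := by
        rw [div_mul_eq_mul_div, div_le_div_iff₀ (by positivity) two_pos]
        nlinarith
      linarith
  obtain ⟨C, hC⟩ := gauss₂_tail hs0 hs1
  filter_upwards [eventually_gt_atTop 1, eventually_le_natCast_rpow C (half_pos hε)] with p hp hCp
  have hT := scale_pos hp
  have hp1 : (1 : ℝ) ≤ p := by exact_mod_cast hp.le
  have hp0 : (0 : ℝ) < p := by linarith
  have hsub : (fun z => (scale p)⁻¹ • z) ⁻¹' A ⊆ {z | scale p ^ 2 * a ≤ normSq₂ z} := by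
    intro z hz
    have h := hA _ hz
    have e : normSq₂ ((scale p)⁻¹ • z) = normSq₂ z / scale p ^ 2 := by
      simp only [normSq₂, Prod.smul_fst, Prod.smul_snd, smul_eq_mul]; field_simp
    rw [e, le_div_iff₀ (by positivity)] at h
    show scale p ^ 2 * a ≤ normSq₂ z
    linarith
  refine (measureReal_mono hsub).trans ((hC _).trans ?_)
  have e1 : s * (scale p ^ 2 * a) / 2 = scale p ^ 2 * (s * a) / 2 := by ring
  rw [e1, exp_scale hp.le]
  calc C * (p : ℝ) ^ (-(s * a)) ≤ p ^ (ε / 2) * p ^ (-a + ε / 2) := by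
        gcongr
        linarith
    _ = (p : ℝ) ^ (-a + ε) := by rw [← Real.rpow_add hp0]; congr 1; ring

/-- The rescaled event contains a small square around `z`, on which the Gaussian law factorizes. -/
lemma gauss₂_lower {A : Set (ℝ × ℝ)} {z : ℝ × ℝ} (hz : z ∈ interior A) {ε : ℝ} (hε : 0 < ε) :
    ∀ᶠ p : ℕ in atTop,
      (p : ℝ) ^ (-normSq₂ z - ε) ≤ gauss₂.real ((fun z => (scale p)⁻¹ • z) ⁻¹' A) := by
  have hcont : ∀ᶠ δ in 𝓝[>] (0 : ℝ), (|z.1| + δ) ^ 2 + (|z.2| + δ) ^ 2 < normSq₂ z + ε := by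
    refine nhdsWithin_le_nhds (ContinuousAt.eventually_lt
      (f := fun δ => (|z.1| + δ) ^ 2 + (|z.2| + δ) ^ 2) (g := fun _ => normSq₂ z + ε)
      (by fun_prop) (by fun_prop) ?_)
    simp [normSq₂, hε]
  obtain ⟨r, hr, hball⟩ := Metric.mem_nhds_iff.1 (mem_interior_iff_mem_nhds.1 hz)
  obtain ⟨δ, hδ1, hδr, hδ⟩ := (hcont.and (((eventually_lt_nhds hr).filter_mono
    nhdsWithin_le_nhds).and (eventually_mem_nhdsWithin))).exists
  have hδ : 0 < δ := hδ
  have hM : ∀ᶠ p : ℕ in atTop, 1 ≤ scale p * (2 * δ / √(2 * Real.pi)) :=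
    (tendsto_scale.atTop_mul_const (by positivity)).eventually_ge_atTop 1
  filter_upwards [hM, eventually_gt_atTop 1] with p hM hp
  have hT := scale_pos hp
  have hp1 : (1 : ℝ) ≤ p := by exact_mod_cast hp.le
  have hp0 : (0 : ℝ) < p := by linarith
  set T := scale p with hTdef
  have hsub : Set.Icc (T * (z.1 - δ)) (T * (z.1 + δ)) ×ˢ Set.Icc (T * (z.2 - δ)) (T * (z.2 + δ)) ⊆
      (fun z => T⁻¹ • z) ⁻¹' A := by
    rintro ⟨x, y⟩ ⟨⟨h1, h2⟩, h3, h4⟩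
    refine hball ?_
    have key : ∀ {x w : ℝ}, T * (w - δ) ≤ x → x ≤ T * (w + δ) → |T⁻¹ * x - w| ≤ δ := by
      intro x w h1 h2
      rw [abs_le, ← div_eq_inv_mul]
      constructor
      · rw [neg_le_sub_iff_le_add, ← sub_le_iff_le_add, le_div_iff₀ hT]; linarith
      · rw [sub_le_iff_le_add, div_le_iff₀ hT]; linarith
    rw [Metric.mem_ball, Prod.dist_eq, max_lt_iff]
    exact ⟨(key h1 h2).trans_lt hδr, (key h3 h4).trans_lt hδr⟩
  refine le_trans ?_ (measureReal_mono hsub)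
  rw [gauss₂, measureReal_prod_prod]
  have key : ∀ x : ℝ, (p : ℝ) ^ (-(|x| + δ) ^ 2) ≤
      (gaussianReal 0 1).real (Set.Icc (T * (x - δ)) (T * (x + δ))) := by
    intro x
    refine le_trans ?_ (le_gaussianReal_Icc hT)
    rw [exp_scale hp.le]
    exact le_mul_of_one_le_left (by positivity) hM
  calc (p : ℝ) ^ (-normSq₂ z - ε) ≤ p ^ (-(|z.1| + δ) ^ 2) * p ^ (-(|z.2| + δ) ^ 2) := by
        rw [← Real.rpow_add hp0]
        exact Real.rpow_le_rpow_of_exponent_le hp1 (by linarith)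
    _ ≤ _ := mul_le_mul (key _) (key _) (by positivity) (by positivity)

/-- The upper bound uses `R ⊆ K`; the lower bound approximates a near-minimizer in `K` by interior
points of `R`. Two sets allow open events to be treated with the rates of their closed versions. -/
lemma hasOrder_gauss₂ {R K : Set (ℝ × ℝ)} (hRK : R ⊆ K) (hne : K.Nonempty)
    (hK : K ⊆ closure (interior R)) :
    HasOrder (fun p => gauss₂.real ((fun z => (scale p)⁻¹ • z) ⁻¹' R)) (rate K) := by
  intro ε hε
  have hz : ∃ z ∈ K, normSq₂ z < rate K + ε / 2 := by
    obtain ⟨_, ⟨z, hz, rfl⟩, h⟩ := exists_lt_of_csInf_lt (hne.image normSq₂)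
      (show sInf (normSq₂ '' K) < rate K + ε / 2 by unfold rate; linarith)
    exact ⟨z, hz, h⟩
  obtain ⟨z, hzK, hz⟩ := hz
  obtain ⟨w, hw, hwR⟩ := mem_closure_iff.1 (hK hzK) {w | normSq₂ w < rate K + ε / 2}
    (isOpen_lt continuous_normSq₂ continuous_const) hz
  filter_upwards [gauss₂_upper (rate_nonneg K) (fun z hz => rate_le (hRK hz)) hε,
    gauss₂_lower hwR (half_pos hε), eventually_gt_atTop 0] with p h1 h2 hp0
  have hp1 : (1 : ℝ) ≤ p := by exact_mod_cast hp0
  have hw : normSq₂ w < rate K + ε / 2 := hw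
  exact ⟨(Real.rpow_le_rpow_of_exponent_le hp1 (by linarith)).trans h2, h1⟩

end Gaussian

/-! ### The Elastic net and the Lasso as threshold rules for the score -/

lemma soft_eq_zero_iff {u : ℝ} (hu : 0 ≤ u) (x : ℝ) : soft u x = 0 ↔ |x| ≤ u := by
  refine ⟨fun h => ?_, soft_of_abs_le⟩
  rw [soft, sub_eq_zero] at h
  rw [abs_le, h]
  exact ⟨le_max_left _ _, max_le (by linarith) (min_le_right _ _)⟩

lemma abs_sub_soft_le {u : ℝ} (hu : 0 ≤ u) (x : ℝ) : |x - soft u x| ≤ u := by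
  simp only [soft, sub_sub_cancel]
  exact abs_le.2 ⟨le_max_left _ _, max_le (by linarith) (min_le_right _ _)⟩

lemma sub_soft_mul_soft {u : ℝ} (hu : 0 ≤ u) (x : ℝ) :
    (x - soft u x) * soft u x = u * |soft u x| := by
  rcases le_total |x| u with h | h
  · simp [soft_of_abs_le h]
  · rcases le_abs.1 h with h | h
    · rw [soft_of_ge hu h, abs_of_nonneg (by linarith)]; ring
    · rw [soft_of_le hu (by linarith), abs_of_nonpos (by linarith)]; ring

/-- The stationarity condition of a one-dimensional penalized quadratic. -/
lemma mul_eq_soft_of_forall_nonneg {m u g b : ℝ} (hm : 0 < m) (hu : 0 ≤ u)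
    (h : ∀ t, 0 ≤ m * t ^ 2 / 2 - t * (g - m * b) + u * (|b + t| - |b|)) : m * b = soft u g := by
  -- The increment leads from `b` to the claimed minimizer `w`. With the subgradient relations at
  -- `w`, it yields `m * (w - b) ^ 2 ≤ 0`.
  have h1 := h (soft u g / m - b)
  set w := soft u g / m with hw
  have hs : soft u g = m * w := by rw [hw]; field_simp
  have h2 : (g - m * w) * w = u * |w| := by
    have := sub_soft_mul_soft hu g
    rw [hs, abs_mul, abs_of_pos hm] at this
    refine mul_left_cancel₀ hm.ne' ?_
    linarith
  have h3 : (g - m * w) * b ≤ u * |b| := by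
    refine (le_abs_self _).trans ?_
    rw [abs_mul]
    exact mul_le_mul_of_nonneg_right (hs ▸ abs_sub_soft_le hu g) (abs_nonneg b)
  rw [add_sub_cancel] at h1
  have h4 : m * (w - b) ^ 2 ≤ 0 := by linarith
  have h5 : w - b = 0 := by
    by_contra h
    have := mul_pos hm (sq_pos_of_ne_zero h)
    linarith
  rw [hs]; congr 1; linarith

/-- The coordinate of `b` at the other index of the block of `j` (zero if there is none). -/
def partnerVal {p : ℕ} (b : Fin p → ℝ) (j : Fin p) : ℝ :=
  ∑ i, if i ≠ j ∧ i.val / 2 = j.val / 2 then b i else 0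

lemma partnerVal_eq {p : ℕ} (b : Fin p → ℝ) {i j : Fin p} (hij : i ≠ j)
    (h : i.val / 2 = j.val / 2) : partnerVal b j = b i := by
  rw [partnerVal, Finset.sum_eq_single i]
  · simp [hij, h]
  · intro k _ hk
    rw [if_neg]
    rintro ⟨h1, h2⟩
    have e1 : i.val ≠ j.val := fun h => hij (Fin.ext h)
    have e2 : k.val ≠ i.val := fun h => hk (Fin.ext h)
    have e3 : k.val ≠ j.val := fun h => h1 (Fin.ext h)
    omega
  · simp

lemma partnerVal_eq_zero {p : ℕ} (b : Fin p → ℝ) {j : Fin p}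
    (h : ∀ i : Fin p, i ≠ j → i.val / 2 ≠ j.val / 2) : partnerVal b j = 0 :=
  Finset.sum_eq_zero fun i _ => if_neg fun hi => h i hi.1 hi.2

lemma gramMatrix_mulVec {p : ℕ} (ρ : ℝ) (b : Fin p → ℝ) (j : Fin p) :
    (gramMatrix ρ p *ᵥ b) j = b j + ρ * partnerVal b j := by
  have : b j = ∑ i, if i = j then b i else 0 := by simp
  rw [partnerVal, this, Finset.mul_sum, ← Finset.sum_add_distrib]
  simp only [Matrix.mulVec, dotProduct, gramMatrix, Matrix.of_apply]
  refine Finset.sum_congr rfl fun i _ => ?_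
  by_cases h : i = j
  · simp [h]
  · by_cases h' : i.val / 2 = j.val / 2
    · simp [h, h', Ne.symm h]
    · simp [h, h', Ne.symm h, Ne.symm h']

/-- The rule which selects `j` if the score of `j` exceeds the threshold in absolute value. -/
def blockRule {p : ℕ} (η lam : ℝ) (h : Fin p → ℝ) : Set (Fin p) :=
  {j | lam < |score η lam (h j) (partnerVal h j)|}

/-- If `x = 0`, the second equation determines `y`. Conversely, if `(0, soft u h₂ / m)` solves the
system, then `(x, y)` equals it, because soft thresholding is nonexpansive and `|ρ| < 1 ≤ m` makes
the system a contraction. -/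
lemma eq_zero_iff_of_stationary {ρ m u h₁ h₂ x y : ℝ} (hρ : |ρ| < 1) (hm : 1 ≤ m) (hu : 0 ≤ u)
    (hx : m * x = soft u (h₁ - ρ * y)) (hy : m * y = soft u (h₂ - ρ * x)) :
    x = 0 ↔ |score (ρ / m) u h₁ h₂| ≤ u := by
  have hm0 : 0 < m := by linarith
  have e : score (ρ / m) u h₁ h₂ = h₁ - ρ * (soft u h₂ / m) := by unfold score; ring
  rw [e, ← soft_eq_zero_iff hu]
  constructor
  · rintro rfl
    rw [mul_zero, sub_zero] at hy
    rw [← hy, mul_div_cancel_left₀ _ hm0.ne', ← hx, mul_zero]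
  · intro h
    have h1 : m * |x| ≤ |ρ| * |y - soft u h₂ / m| := by
      have := abs_soft_sub_le u (h₁ - ρ * y) (h₁ - ρ * (soft u h₂ / m))
      rw [h, ← hx, sub_zero, abs_mul, abs_of_pos hm0] at this
      refine this.trans (le_of_eq ?_)
      rw [abs_sub_comm y, ← abs_mul]; congr 1; ring
    have h2 : m * |y - soft u h₂ / m| ≤ |ρ| * |x| := by
      have := abs_soft_sub_le u (h₂ - ρ * x) h₂
      rw [← hy] at this
      rw [← abs_of_pos hm0, ← abs_mul, abs_of_pos hm0, ← abs_mul, mul_sub,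
        mul_div_cancel₀ _ hm0.ne']
      refine this.trans (le_of_eq ?_)
      rw [← abs_neg]; congr 1; ring
    have h3 : |x| ≤ |ρ| * |y - soft u h₂ / m| :=
      (le_mul_of_one_le_left (abs_nonneg x) hm).trans h1
    have h4 : |y - soft u h₂ / m| ≤ |ρ| * |x| :=
      (le_mul_of_one_le_left (abs_nonneg _) hm).trans h2
    have h5 : |ρ| * |y - soft u h₂ / m| ≤ |y - soft u h₂ / m| :=
      mul_le_of_le_one_left (abs_nonneg _) hρ.le
    by_contra hx0
    have := mul_lt_of_lt_one_left (abs_pos.2 hx0) hρ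
    linarith

section Estimator

variable {n p : ℕ} {X : Matrix (Fin n) (Fin p) ℝ} {ρ lam μ : ℝ}

/-- The objective function of the Elastic net. -/
def enObjective (X : Matrix (Fin n) (Fin p) ℝ) (lam μ : ℝ) (y : Fin n → ℝ) (b : Fin p → ℝ) : ℝ :=
  (∑ i, (y i - (X *ᵥ b) i) ^ 2) / 2 + lam * ∑ j, |b j| + μ / 2 * ∑ j, b j ^ 2

lemma exists_forall_enObjective_le (hlam : 0 < lam) (hμ : 0 ≤ μ) (y : Fin n → ℝ) :
    ∃ b, ∀ b', enObjective X lam μ y b ≤ enObjective X lam μ y b' := by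
  refine Continuous.exists_forall_le ?_ ?_
  · unfold enObjective Matrix.mulVec dotProduct
    fun_prop
  · refine tendsto_atTop_mono (fun b => ?_)
      ((tendsto_norm_cocompact_atTop (E := Fin p → ℝ)).const_mul_atTop hlam)
    have h1 : ‖b‖ ≤ ∑ j, |b j| := by
      refine (pi_norm_le_iff_of_nonneg (Finset.sum_nonneg fun _ _ => abs_nonneg _)).2 fun j => ?_
      exact Finset.single_le_sum (f := fun j => |b j|) (fun _ _ => abs_nonneg _)
        (Finset.mem_univ j)
    have h2 : 0 ≤ ∑ i, (y i - (X *ᵥ b) i) ^ 2 := Finset.sum_nonneg fun _ _ => sq_nonneg _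
    have h3 : 0 ≤ μ / 2 * ∑ j, b j ^ 2 :=
      mul_nonneg (by linarith) (Finset.sum_nonneg fun _ _ => sq_nonneg _)
    unfold enObjective
    nlinarith

/-- A change of one coordinate sees the rest of `b` only through its block partner, as columns of
different blocks are orthogonal. -/
lemma enObjective_add_single (hX : Xᵀ * X = gramMatrix ρ p) (y : Fin n → ℝ) (b : Fin p → ℝ)
    (j : Fin p) (t : ℝ) :
    enObjective X lam μ y (b + Pi.single j t) - enObjective X lam μ y b =
      (1 + μ) * t ^ 2 / 2 - t * ((Xᵀ *ᵥ y) j - ρ * partnerVal b j - (1 + μ) * b j) +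
        lam * (|b j + t| - |b j|) := by
  have hsum : ∀ f : ℝ → ℝ, ∑ k, f ((b + Pi.single j t : Fin p → ℝ) k) - ∑ k, f (b k) =
      f (b j + t) - f (b j) := by
    intro f
    rw [← Finset.sum_sub_distrib, Finset.sum_eq_single j]
    · simp
    · intro k _ hk; simp [hk]
    · simp
  have h1 := hsum (fun x => |x|)
  have h2 := hsum (fun x => x ^ 2)
  have hcol : ∑ i, X i j ^ 2 = 1 := by
    have := congrFun (congrFun hX j) j
    simpa [Matrix.mul_apply, gramMatrix, sq] using this
  have hin : ∑ i, (y i - (X *ᵥ b) i) * X i j = (Xᵀ *ᵥ y) j - (b j + ρ * partnerVal b j) := by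
    rw [← gramMatrix_mulVec, ← hX, ← Matrix.mulVec_mulVec, ← Pi.sub_apply, ← Matrix.mulVec_sub]
    simp only [Matrix.mulVec, dotProduct, Matrix.transpose_apply, Pi.sub_apply]
    exact Finset.sum_congr rfl fun i _ => by ring
  have h3 : ∑ i, (y i - (X *ᵥ (b + Pi.single j t)) i) ^ 2 =
      ∑ i, (y i - (X *ᵥ b) i) ^ 2 - 2 * t * ∑ i, (y i - (X *ᵥ b) i) * X i j +
        t ^ 2 * ∑ i, X i j ^ 2 := by
    rw [Finset.mul_sum, Finset.mul_sum, ← Finset.sum_sub_distrib, ← Finset.sum_add_distrib]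
    refine Finset.sum_congr rfl fun i _ => ?_
    simp only [Matrix.mulVec_add, Pi.add_apply, Matrix.mulVec_single, op_smul_eq_mul,
      Pi.smul_apply, Matrix.col_apply]
    ring
  rw [hcol, hin] at h3
  unfold enObjective
  rw [h3]
  linear_combination lam * h1 + μ / 2 * h2

lemma elasticNetEstimator_support (hρ : |ρ| < 1) (hX : Xᵀ * X = gramMatrix ρ p) (hlam : 0 < lam)
    (hμ : 0 ≤ μ) (y : Fin n → ℝ) :
    {j | elasticNetEstimator X lam μ y j ≠ 0} = blockRule (ρ / (1 + μ)) lam (Xᵀ *ᵥ y) := by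
  set b := elasticNetEstimator X lam μ y with hb
  have hmin : ∀ b', enObjective X lam μ y b ≤ enObjective X lam μ y b' :=
    Classical.epsilon_spec (exists_forall_enObjective_le (X := X) hlam hμ y)
  have hm : 0 < 1 + μ := by linarith
  have hst : ∀ j, (1 + μ) * b j = soft lam ((Xᵀ *ᵥ y) j - ρ * partnerVal b j) := by
    intro j
    refine mul_eq_soft_of_forall_nonneg hm hlam.le fun t => ?_
    rw [← enObjective_add_single hX]
    exact sub_nonneg.2 (hmin _)
  ext j
  simp only [blockRule, Set.mem_ofPred_eq, ne_eq, ← not_le]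
  refine not_congr ?_
  by_cases h : ∃ i : Fin p, i ≠ j ∧ i.val / 2 = j.val / 2
  · obtain ⟨i, hij, hi⟩ := h
    have h1 := hst j
    have h2 := hst i
    rw [partnerVal_eq _ hij hi] at h1 ⊢
    rw [partnerVal_eq _ hij.symm hi.symm] at h2
    exact eq_zero_iff_of_stationary hρ (by linarith) hlam.le h1 h2
  · have h1 := hst j
    have h' : ∀ i : Fin p, i ≠ j → i.val / 2 ≠ j.val / 2 := fun i h1 h2 => h ⟨i, h1, h2⟩
    rw [partnerVal_eq_zero _ h'] at h1 ⊢
    rw [mul_zero, sub_zero] at h1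
    -- An unpaired variable has partner value `0`, so its score is its own entry of `Xᵀ y`.
    rw [score, soft_of_abs_le (by simpa using hlam.le), mul_zero, sub_zero,
      ← soft_eq_zero_iff hlam.le, ← h1]
    simp [hm.ne']

lemma lassoEstimator_eq (y : Fin n → ℝ) :
    lassoEstimator X lam y = elasticNetEstimator X lam 0 y := by
  simp [lassoEstimator, elasticNetEstimator]

end Estimator

lemma level_eq {q : ℝ} (hq : 0 ≤ q) (p : ℕ) : level q p = scale p * √q := by
  rw [level, scale, ← Real.sqrt_mul' _ hq]; congr 1; ring

section Rules

variable {ρ : ℝ} {n : ℕ → ℕ} {X : ∀ p, Matrix (Fin (n p)) (Fin p) ℝ} {p : ℕ} {q : ℝ}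

lemma elasticNet_eq (hρ : |ρ| < 1) (hX : ∀ p, (X p)ᵀ * X p = gramMatrix ρ p) {μ : ℝ} (hμ : 0 ≤ μ)
    (hq : 0 < q) (hp : 1 < p) (y : Fin (n p) → ℝ) :
    elasticNet X μ q p y = blockRule ((1 + μ)⁻¹ * ρ) (level q p) ((X p)ᵀ *ᵥ y) := by
  rw [elasticNet, elasticNetEstimator_support hρ (hX p)
    (by rw [level_eq hq.le]; exact mul_pos (scale_pos hp) (Real.sqrt_pos.2 hq)) hμ, div_eq_inv_mul]

lemma lasso_eq (hρ : |ρ| < 1) (hX : ∀ p, (X p)ᵀ * X p = gramMatrix ρ p)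
    (hq : 0 < q) (hp : 1 < p) (y : Fin (n p) → ℝ) :
    lasso X q p y = blockRule (1 * ρ) (level q p) ((X p)ᵀ *ᵥ y) := by
  have := elasticNet_eq hρ hX le_rfl hq hp y
  rw [add_zero, inv_one] at this
  rw [← this, lasso, elasticNet, lassoEstimator_eq]

lemma marginalRegression_eq (y : Fin (n p) → ℝ) :
    marginalRegression X q p y = blockRule (0 * ρ) (level q p) ((X p)ᵀ *ᵥ y) := by
  simp [marginalRegression, blockRule, score]

end Rules

/-! ### The laws of the coefficients and of the noise in a block -/

section Laws

lemma map_pi_pair {ι : Type*} [Fintype ι] (ν : Measure ℝ) [IsProbabilityMeasure ν] {i j : ι}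
    (h : i ≠ j) :
    (Measure.pi fun _ : ι => ν).map (fun β => (β i, β j)) = ν.prod ν := by
  have h1 : iIndepFun (fun (i : ι) (β : ι → ℝ) => β i) (Measure.pi fun _ => ν) :=
    iIndepFun_pi (X := fun _ => id) fun _ => aemeasurable_id
  rw [(indepFun_iff_map_prod_eq_prod_map_map (measurable_pi_apply i).aemeasurable
    (measurable_pi_apply j).aemeasurable).1 (h1.indepFun h)]
  congr 1 <;> exact (measurePreserving_eval (fun _ => ν) _).map_eq

section Noise

variable {n : ℕ}

instance : IsProbabilityMeasure (noiseLaw n) := by unfold noiseLaw; infer_instance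

lemma iIndepFun_noiseLaw : iIndepFun (fun (i : Fin n) (z : Fin n → ℝ) => z i) (noiseLaw n) :=
  iIndepFun_pi (X := fun _ => id) fun _ => aemeasurable_id

lemma map_eval_noiseLaw (i : Fin n) :
    (noiseLaw n).map (fun z => z i) = gaussianReal 0 1 :=
  (measurePreserving_eval (fun _ => gaussianReal 0 1) i).map_eq

lemma hasGaussianLaw_eval_noiseLaw (i : Fin n) :
    HasGaussianLaw (fun z : Fin n → ℝ => z i) (noiseLaw n) :=
  ⟨by rw [map_eval_noiseLaw]; infer_instance⟩

lemma hasGaussianLaw_noiseLaw : HasGaussianLaw (fun z : Fin n → ℝ => (z ·)) (noiseLaw n) :=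
  iIndepFun_noiseLaw.hasGaussianLaw hasGaussianLaw_eval_noiseLaw

lemma memLp_eval_noiseLaw (i : Fin n) : MemLp (fun z : Fin n → ℝ => z i) 2 (noiseLaw n) :=
  (hasGaussianLaw_eval_noiseLaw i).memLp_two

lemma covariance_eval_noiseLaw (i j : Fin n) :
    cov[fun z => z i, fun z => z j; noiseLaw n] = if i = j then 1 else 0 := by
  split_ifs with h
  · subst h
    rw [covariance_self (measurable_pi_apply i).aemeasurable]
    have := variance_id_gaussianReal (μ := 0) (v := 1)
    rw [← map_eval_noiseLaw i, variance_map (X := id) aemeasurable_id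
      (measurable_pi_apply (X := fun _ : Fin n => ℝ) i).aemeasurable] at this
    simpa using this
  · exact (iIndepFun_noiseLaw.indepFun h).covariance_eq_zero (memLp_eval_noiseLaw i)
      (memLp_eval_noiseLaw j)

lemma covariance_dotProduct_noiseLaw (a b : Fin n → ℝ) :
    cov[fun z => a ⬝ᵥ z, fun z => b ⬝ᵥ z; noiseLaw n] = a ⬝ᵥ b := by
  simp only [dotProduct]
  rw [covariance_fun_sum_fun_sum (fun i => (memLp_eval_noiseLaw i).const_mul _)
    (fun i => (memLp_eval_noiseLaw i).const_mul _)]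
  simp [covariance_const_mul_left, covariance_const_mul_right, covariance_eval_noiseLaw, mul_comm]

lemma hasGaussianLaw_dotProduct_noiseLaw (a b : Fin n → ℝ) :
    HasGaussianLaw (fun z => (a ⬝ᵥ z, b ⬝ᵥ z)) (noiseLaw n) := by
  have := hasGaussianLaw_noiseLaw (n := n).map_fun
    ((∑ i, a i • ContinuousLinearMap.proj (R := ℝ) (φ := fun _ : Fin n => ℝ) i).prod
      (∑ i, b i • ContinuousLinearMap.proj (R := ℝ) (φ := fun _ : Fin n => ℝ) i))
  simpa [dotProduct] using this

lemma integral_dotProduct_noiseLaw (a : Fin n → ℝ) : ∫ z, a ⬝ᵥ z ∂noiseLaw n = 0 := by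
  simp only [dotProduct]
  rw [integral_finsetSum _ fun i _ => ((memLp_eval_noiseLaw i).integrable (by simp)).const_mul _]
  refine Finset.sum_eq_zero fun i _ => ?_
  have := integral_id_gaussianReal (μ := 0) (v := 1)
  rw [← map_eval_noiseLaw i, integral_map (measurable_pi_apply i).aemeasurable (by fun_prop)] at this
  rw [integral_const_mul, this, mul_zero]

lemma map_dotProduct_noiseLaw {a : Fin n → ℝ} (ha : a ⬝ᵥ a = 1) :
    (noiseLaw n).map (fun z => a ⬝ᵥ z) = gaussianReal 0 1 := by
  rw [(hasGaussianLaw_dotProduct_noiseLaw a a).fst.map_eq_gaussianReal,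
    integral_dotProduct_noiseLaw, ← covariance_self, covariance_dotProduct_noiseLaw, ha]
  · simp
  · exact Measurable.aemeasurable (by unfold dotProduct; fun_prop)

/-- Jointly Gaussian and uncorrelated coordinates are independent. -/
lemma map_pair_noiseLaw {a b : Fin n → ℝ} (ha : a ⬝ᵥ a = 1) (hb : b ⬝ᵥ b = 1)
    (hab : a ⬝ᵥ b = 0) :
    (noiseLaw n).map (fun z => (a ⬝ᵥ z, b ⬝ᵥ z)) = gauss₂ := by
  have h := hasGaussianLaw_dotProduct_noiseLaw a b
  rw [(indepFun_iff_map_prod_eq_prod_map_map h.fst.aemeasurable h.snd.aemeasurable).1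
    (h.indepFun_of_covariance_eq_zero (by rw [covariance_dotProduct_noiseLaw, hab])),
    map_dotProduct_noiseLaw ha, map_dotProduct_noiseLaw hb, gauss₂]

end Noise

section TwoPoint

/-- The law of one coefficient: `τ` with probability `ε`, otherwise `0`. -/
def twoPoint (ε τ : ℝ) : Measure ℝ :=
  ENNReal.ofReal (1 - ε) • Measure.dirac (0 : ℝ) + ENNReal.ofReal ε • Measure.dirac τ

variable {ε : ℝ} (τ : ℝ)

lemma isProbabilityMeasure_twoPoint (h0 : 0 ≤ ε) (h1 : ε ≤ 1) :
    IsProbabilityMeasure (twoPoint ε τ) := by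
  constructor
  simp only [twoPoint, Measure.add_apply, Measure.smul_apply, measure_univ, smul_eq_mul, mul_one]
  rw [← ENNReal.ofReal_add (by linarith) h0]
  simp

instance : IsFiniteMeasure (twoPoint ε τ) := by
  unfold twoPoint
  have h (a x : ℝ) : IsFiniteMeasure (ENNReal.ofReal a • Measure.dirac x) :=
    Measure.smul_finite _ ENNReal.ofReal_ne_top
  have := h (1 - ε) 0
  have := h ε τ
  infer_instance

lemma lintegral_twoPoint (f : ℝ → ℝ≥0∞) :
    ∫⁻ x, f x ∂twoPoint ε τ = ENNReal.ofReal (1 - ε) * f 0 + ENNReal.ofReal ε * f τ := by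
  simp [twoPoint, lintegral_add_measure, lintegral_smul_measure]

lemma twoPoint_prod_real (h0 : 0 ≤ ε) (h1 : ε ≤ 1) {α : Type*} [MeasurableSpace α] (γ : Measure α)
    [IsFiniteMeasure γ] {A : Set (ℝ × α)} (hA : MeasurableSet A) :
    ((twoPoint ε τ).prod γ).real A =
      (1 - ε) * γ.real {z | (0, z) ∈ A} + ε * γ.real {z | (τ, z) ∈ A} := by
  rw [Measure.real, Measure.prod_apply hA, lintegral_twoPoint, ENNReal.toReal_add, ENNReal.toReal_mul,
    ENNReal.toReal_mul, ENNReal.toReal_ofReal (by linarith), ENNReal.toReal_ofReal h0]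
  · rfl
  all_goals exact ENNReal.mul_ne_top ENNReal.ofReal_ne_top (measure_ne_top _ _)

lemma twoPoint_prod_prod_real (h0 : 0 ≤ ε) (h1 : ε ≤ 1) {α : Type*} [MeasurableSpace α]
    (γ : Measure α) [IsFiniteMeasure γ] {A : Set ((ℝ × ℝ) × α)} (hA : MeasurableSet A) :
    (((twoPoint ε τ).prod (twoPoint ε τ)).prod γ).real A =
      ((1 - ε) * ((1 - ε) * γ.real {z | ((0, 0), z) ∈ A} + ε * γ.real {z | ((0, τ), z) ∈ A})) +
        (ε * ((1 - ε) * γ.real {z | ((τ, 0), z) ∈ A} + ε * γ.real {z | ((τ, τ), z) ∈ A})) := by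
  have hB : MeasurableSet ((fun x : ℝ × ℝ × α => ((x.1, x.2.1), x.2.2)) ⁻¹' A) :=
    hA.preimage (by fun_prop)
  have h2 : ((twoPoint ε τ).prod (twoPoint ε τ)).prod γ =
      ((twoPoint ε τ).prod ((twoPoint ε τ).prod γ)).map (fun x => ((x.1, x.2.1), x.2.2)) :=
    (measurePreserving_prodAssoc _ _ γ).symm.map_eq.symm
  rw [h2, map_measureReal_apply (by fun_prop) hA, twoPoint_prod_real τ h0 h1 _ hB]
  have h3 (x : ℝ) := twoPoint_prod_real τ h0 h1 γ
    (hB.preimage (measurable_prodMk_left (x := x)))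
  exact congrArg₂ _ (congrArg _ (h3 0)) (congrArg _ (h3 τ))

lemma coefLaw_eq (ϑ r : ℝ) (p : ℕ) :
    coefLaw ϑ r p = Measure.pi fun _ => twoPoint ((p : ℝ) ^ (-ϑ)) (√(2 * r * Real.log p)) := rfl

end TwoPoint

end Laws

/-! ### The expected Hamming error as a sum of error probabilities -/

section Hamming

variable {p : ℕ}

/-- The set of indices which are classified wrongly. -/
def errorSet (S : Set (Fin p)) (β : Fin p → ℝ) : Set (Fin p) :=
  {j | (j ∈ S ∧ β j = 0) ∨ (j ∉ S ∧ β j ≠ 0)}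

lemma hammingError_eq (S : Set (Fin p)) (β : Fin p → ℝ) :
    (hammingError S β : ℝ) = ∑ j, (errorSet S β).indicator (fun _ => (1 : ℝ)) j := by
  classical
  rw [hammingError, ← Set.ncard_union_eq]
  · have : {j | j ∈ S ∧ β j = 0} ∪ {j | j ∉ S ∧ β j ≠ 0} = errorSet S β := by
      ext j; simp [errorSet]
    rw [this, Set.ncard_eq_toFinset_card']
    simp [Set.indicator_apply]
  · rw [Set.disjoint_left]
    rintro j ⟨h1, -⟩ ⟨h2, -⟩
    exact h2 h1

lemma expectedHamming_eq_sum {n : ℕ} (X : Matrix (Fin n) (Fin p) ℝ) (ϑ r : ℝ)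
    [IsFiniteMeasure (coefLaw ϑ r p)] (S : (Fin n → ℝ) → Set (Fin p))
    (hS : ∀ j, MeasurableSet {y | j ∈ S y}) :
    expectedHamming X ϑ r S = ∑ j, ((coefLaw ϑ r p).prod (noiseLaw n)).real
      {ω | j ∈ errorSet (S (X *ᵥ ω.1 + ω.2)) ω.1} := by
  have hmeas : ∀ j, MeasurableSet {ω : (Fin p → ℝ) × (Fin n → ℝ) |
      j ∈ errorSet (S (X *ᵥ ω.1 + ω.2)) ω.1} := by
    intro j
    have h1 : MeasurableSet {ω : (Fin p → ℝ) × (Fin n → ℝ) | j ∈ S (X *ᵥ ω.1 + ω.2)} := by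
      refine (hS j).preimage (f := fun ω : (Fin p → ℝ) × (Fin n → ℝ) => X *ᵥ ω.1 + ω.2) ?_
      exact Continuous.measurable (by fun_prop)
    have h2 : MeasurableSet {ω : (Fin p → ℝ) × (Fin n → ℝ) | ω.1 j = 0} :=
      measurableSet_eq_fun (by fun_prop) measurable_const
    exact (h1.inter h2).union (h1.compl.inter h2.compl)
  unfold expectedHamming
  simp only [hammingError_eq]
  have hind : ∀ (j : Fin p) (ω : (Fin p → ℝ) × (Fin n → ℝ)),
      (errorSet (S (X *ᵥ ω.1 + ω.2)) ω.1).indicator (fun _ => (1 : ℝ)) j =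
        {ω : (Fin p → ℝ) × (Fin n → ℝ) | j ∈ errorSet (S (X *ᵥ ω.1 + ω.2)) ω.1}.indicator
          (fun _ => (1 : ℝ)) ω := fun j ω => rfl
  simp only [hind]
  rw [integral_finsetSum _ fun j _ => (integrable_const 1).indicator (hmeas j)]
  refine Finset.sum_congr rfl fun j _ => ?_
  rw [integral_indicator_const _ (hmeas j)]
  simp

end Hamming

/-! ### Regularity and scaling of the error sets -/

/-- The open version of `fpSet`. -/
def fpSet' (ρ η u b : ℝ) : Set (ℝ × ℝ) := {z | u < |pairScore ρ η u 0 b z|}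

lemma isOpen_fpSet' (ρ η u b : ℝ) : IsOpen (fpSet' ρ η u b) :=
  isOpen_lt continuous_const (by fun_prop)

section Closure

variable {ρ u : ℝ}

lemma mem_closure_of_pairScore (hρ : |ρ| < 1) (η u b₁ b₂ : ℝ) {z : ℝ × ℝ} {A : Set (ℝ × ℝ)}
    {c : ℝ}
    (h : ∀ δ : ℝ, 0 < δ → δ < 1 → ∀ w, pairScore ρ η u b₁ b₂ w =
      pairScore ρ η u b₁ b₂ z + δ * c → w ∈ A) : z ∈ closure A := by
  have hcont : Continuous fun δ : ℝ => (z.1 + δ * c, z.2 - ρ * (δ * c) / √(1 - ρ ^ 2)) := by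
    fun_prop
  have ht : Tendsto (fun δ : ℝ => (z.1 + δ * c, z.2 - ρ * (δ * c) / √(1 - ρ ^ 2))) (𝓝[>] 0)
      (𝓝 z) := by
    have := hcont.tendsto 0
    simp only [zero_mul, add_zero, mul_zero, zero_div, sub_zero] at this
    exact this.mono_left nhdsWithin_le_nhds
  refine mem_closure_of_tendsto ht ?_
  filter_upwards [eventually_mem_nhdsWithin,
    (eventually_lt_nhds one_pos).filter_mono nhdsWithin_le_nhds] with δ h0 h1
  exact h δ h0 h1 _ (pairScore_shift hρ η u b₁ b₂ (δ * c) z)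

/-- Multiplying the score by `1 + δ` moves a boundary point into the open set. -/
lemma fpSet_subset_closure (hρ : |ρ| < 1) (hu : 0 < u) (η b : ℝ) :
    fpSet ρ η u b ⊆ closure (interior (fpSet' ρ η u b)) := by
  intro z hz
  rw [(isOpen_fpSet' ρ η u b).interior_eq]
  have hz : u ≤ |pairScore ρ η u 0 b z| := hz
  refine mem_closure_of_pairScore hρ η u 0 b (c := pairScore ρ η u 0 b z) fun δ h0 _ w hw => ?_
  have e : pairScore ρ η u 0 b w = (1 + δ) * pairScore ρ η u 0 b z := by rw [hw]; ring
  show u < |pairScore ρ η u 0 b w|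
  rw [e, abs_mul, abs_of_pos (by linarith)]
  nlinarith

lemma fnSet_subset_closure (hρ : |ρ| < 1) (hu : 0 < u) (η v b : ℝ) :
    fnSet ρ η u v b ⊆ closure (interior (fnSet ρ η u v b)) := by
  intro z hz
  have hz : |pairScore ρ η u v b z| ≤ u := hz
  have hsub : {w | |pairScore ρ η u v b w| < u} ⊆ interior (fnSet ρ η u v b) :=
    interior_maximal (Set.ofPred_subset_ofPred.2 fun w hw => le_of_lt hw) (isOpen_lt (by fun_prop) continuous_const)
  refine closure_mono hsub ?_
  refine mem_closure_of_pairScore hρ η u v b (c := -pairScore ρ η u v b z) fun δ h0 h1 w hw => ?_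
  have e : pairScore ρ η u v b w = (1 - δ) * pairScore ρ η u v b z := by rw [hw]; ring
  show |pairScore ρ η u v b w| < u
  rw [e, abs_mul, abs_of_pos (by linarith)]
  nlinarith

/-- Homogeneity of the score: the common factor `√(2 log p)` of threshold and signals passes to the
noise. -/
lemma pairScore_mul {t : ℝ} (ht : 0 < t) (ρ η u b₁ b₂ : ℝ) (z : ℝ × ℝ) :
    pairScore ρ η (t * u) (t * b₁) (t * b₂) z = t * pairScore ρ η u b₁ b₂ (t⁻¹ • z) := by
  have h1 : t * b₁ + ρ * (t * b₂) + z.1 = t * (b₁ + ρ * b₂ + t⁻¹ * z.1) := by field_simp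
  have h2 : ρ * (t * b₁) + t * b₂ + ρ * z.1 + √(1 - ρ ^ 2) * z.2 =
      t * (ρ * b₁ + b₂ + ρ * (t⁻¹ * z.1) + √(1 - ρ ^ 2) * (t⁻¹ * z.2)) := by field_simp
  simp only [pairScore, score, Prod.smul_fst, Prod.smul_snd, smul_eq_mul, h1, h2, soft_mul ht.le]
  ring

end Closure

/-! ### Error probabilities of single variables -/

/-- The Gaussian measure of a set at scale `√(2 log p)`. -/
def scaledProb (A : Set (ℝ × ℝ)) (p : ℕ) : ℝ := gauss₂.real ((fun z => (scale p)⁻¹ • z) ⁻¹' A)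

/-- The probability that a variable in a block of size two is classified wrongly. -/
def pairErrorProb (ρ η ϑ u v : ℝ) (p : ℕ) : ℝ :=
  ((1 - (p : ℝ) ^ (-ϑ)) * ((1 - (p : ℝ) ^ (-ϑ)) * scaledProb (fpSet' ρ η u 0) p +
      (p : ℝ) ^ (-ϑ) * scaledProb (fpSet' ρ η u v) p)) +
    ((p : ℝ) ^ (-ϑ) * ((1 - (p : ℝ) ^ (-ϑ)) * scaledProb (fnSet ρ η u v 0) p +
      (p : ℝ) ^ (-ϑ) * scaledProb (fnSet ρ η u v v) p))

lemma hasOrder_pairErrorProb {ρ η ϑ u v : ℝ} (hρ : |ρ| < 1) (hϑ : 0 < ϑ) (hu : 0 < u) :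
    HasOrder (pairErrorProb ρ η ϑ u v) (pairExponent ρ η ϑ u v) := by
  have hfp (b : ℝ) : HasOrder (scaledProb (fpSet' ρ η u b)) (rate (fpSet ρ η u b)) :=
    hasOrder_gauss₂ (Set.ofPred_subset_ofPred.2 fun _ h => le_of_lt h) (fpSet_nonempty hρ _ _ _)
      (fpSet_subset_closure hρ hu _ _)
  have hfn (b : ℝ) : HasOrder (scaledProb (fnSet ρ η u v b)) (rate (fnSet ρ η u v b)) :=
    hasOrder_gauss₂ subset_rfl (fnSet_nonempty hρ hu.le _ _ _) (fnSet_subset_closure hρ hu _ _ _)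
  have h0 := hasOrder_one_sub hϑ
  have h1 := hasOrder_rpow ϑ
  have := (h0.mul ((h0.mul (hfp 0)).add (h1.mul (hfp v)))).add
    (h1.mul ((h0.mul (hfn 0)).add (h1.mul (hfn v))))
  simp only [zero_add, ← min_add_add_left, ← add_assoc, ← two_mul] at this
  exact this

lemma rpow_neg_mem_Icc {ϑ : ℝ} (hϑ : 0 ≤ ϑ) {p : ℕ} (hp : 1 ≤ p) :
    0 ≤ (p : ℝ) ^ (-ϑ) ∧ (p : ℝ) ^ (-ϑ) ≤ 1 :=
  ⟨by positivity, Real.rpow_le_one_of_one_le_of_nonpos (by exact_mod_cast hp) (by linarith)⟩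

section Design

variable {ρ : ℝ} {n p : ℕ} {X : Matrix (Fin n) (Fin p) ℝ}

lemma col_dotProduct_col (hX : Xᵀ * X = gramMatrix ρ p) (i j : Fin p) :
    X.col i ⬝ᵥ X.col j = if i = j then 1 else if i.val / 2 = j.val / 2 then ρ else 0 :=
  congrFun (congrFun hX i) j

lemma transpose_mulVec_response (hX : Xᵀ * X = gramMatrix ρ p) (β : Fin p → ℝ) (z : Fin n → ℝ)
    (j : Fin p) :
    (Xᵀ *ᵥ (X *ᵥ β + z)) j = β j + ρ * partnerVal β j + X.col j ⬝ᵥ z := by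
  rw [Matrix.mulVec_add, Matrix.mulVec_mulVec, hX, Pi.add_apply, gramMatrix_mulVec]
  rfl

/-- The normalized residual of the second column of a block after regression on the first. -/
def residualCol (ρ : ℝ) (X : Matrix (Fin n) (Fin p) ℝ) (i j : Fin p) : Fin n → ℝ :=
  (√(1 - ρ ^ 2))⁻¹ • (X.col i - ρ • X.col j)

lemma sq_sqrt_one_sub_sq (hρ : |ρ| < 1) : √(1 - ρ ^ 2) ^ 2 = 1 - ρ ^ 2 :=
  Real.sq_sqrt (by nlinarith [(sq_lt_one_iff_abs_lt_one ρ).2 hρ])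

lemma col_eq_residualCol (hρ : |ρ| < 1) (i j : Fin p) (z : Fin n → ℝ) :
    X.col i ⬝ᵥ z = ρ * (X.col j ⬝ᵥ z) + √(1 - ρ ^ 2) * (residualCol ρ X i j ⬝ᵥ z) := by
  have := (kappa_pos hρ).ne'
  simp only [residualCol, smul_dotProduct, sub_dotProduct, smul_eq_mul]
  field_simp
  ring

/-- Gram–Schmidt: the first column and the normalized residual are orthonormal. -/
lemma map_cols_noiseLaw (hρ : |ρ| < 1) (hX : Xᵀ * X = gramMatrix ρ p) {i j : Fin p} (hij : i ≠ j)
    (h : i.val / 2 = j.val / 2) :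
    (noiseLaw n).map (fun z => (X.col j ⬝ᵥ z, residualCol ρ X i j ⬝ᵥ z)) = gauss₂ := by
  have hκ := (kappa_pos hρ).ne'
  have hκ2 := sq_sqrt_one_sub_sq hρ
  refine map_pair_noiseLaw (by simp [col_dotProduct_col hX]) ?_ ?_
  · simp only [residualCol, smul_dotProduct, dotProduct_smul, sub_dotProduct, dotProduct_sub,
      col_dotProduct_col hX, smul_eq_mul, hij, hij.symm, h, if_true, if_false]
    field_simp
    linarith
  · simp [residualCol, dotProduct_smul, dotProduct_sub, col_dotProduct_col hX, hij.symm, h]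

/-- The event that the first variable of a block is classified wrongly, in terms of the
coefficients of the block and the noise. -/
def pairErrorEvent (ρ η u : ℝ) : Set ((ℝ × ℝ) × (ℝ × ℝ)) :=
  {x | (u < |pairScore ρ η u x.1.1 x.1.2 x.2| ∧ x.1.1 = 0) ∨
    (¬ u < |pairScore ρ η u x.1.1 x.1.2 x.2| ∧ x.1.1 ≠ 0)}

lemma measurableSet_pairErrorEvent (ρ η u : ℝ) : MeasurableSet (pairErrorEvent ρ η u) := by
  have hc : Continuous fun x : (ℝ × ℝ) × (ℝ × ℝ) => pairScore ρ η u x.1.1 x.1.2 x.2 := by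
    unfold pairScore score; fun_prop
  have h1 : MeasurableSet {x : (ℝ × ℝ) × (ℝ × ℝ) | u < |pairScore ρ η u x.1.1 x.1.2 x.2|} :=
    measurableSet_lt measurable_const hc.abs.measurable
  have h2 : MeasurableSet {x : (ℝ × ℝ) × (ℝ × ℝ) | x.1.1 = 0} :=
    measurableSet_eq_fun (by fun_prop) measurable_const
  exact (h1.inter h2).union (h1.compl.inter h2.compl)

lemma sqrt_coef_eq {r : ℝ} (hr : 0 ≤ r) (p : ℕ) : √(2 * r * Real.log p) = scale p * √r :=
  level_eq hr p

lemma measureReal_error_pair (hρ : |ρ| < 1) (hX : Xᵀ * X = gramMatrix ρ p) {ϑ r u : ℝ}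
    (hϑ : 0 ≤ ϑ) (hr : 0 < r) (hp : 1 < p) (η : ℝ) {i j : Fin p} (hij : i ≠ j)
    (h : i.val / 2 = j.val / 2) :
    ((coefLaw ϑ r p).prod (noiseLaw n)).real {ω | j ∈
      errorSet (blockRule η (scale p * u) (Xᵀ *ᵥ (X *ᵥ ω.1 + ω.2))) ω.1} =
      pairErrorProb ρ η ϑ u √r p := by
  obtain ⟨h0, h1⟩ := rpow_neg_mem_Icc hϑ hp.le
  have := isProbabilityMeasure_twoPoint (scale p * √r) h0 h1
  have hset : {ω : (Fin p → ℝ) × (Fin n → ℝ) | j ∈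
      errorSet (blockRule η (scale p * u) (Xᵀ *ᵥ (X *ᵥ ω.1 + ω.2))) ω.1} =
      Prod.map (fun β : Fin p → ℝ => (β j, β i))
        (fun z : Fin n → ℝ => (X.col j ⬝ᵥ z, residualCol ρ X i j ⬝ᵥ z)) ⁻¹'
        pairErrorEvent ρ η (scale p * u) := by
    ext ω
    have e : score η (scale p * u) ((Xᵀ *ᵥ (X *ᵥ ω.1 + ω.2)) j)
        (partnerVal (Xᵀ *ᵥ (X *ᵥ ω.1 + ω.2)) j) = pairScore ρ η (scale p * u) (ω.1 j) (ω.1 i)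
          (X.col j ⬝ᵥ ω.2, residualCol ρ X i j ⬝ᵥ ω.2) := by
      rw [partnerVal_eq _ hij h, transpose_mulVec_response hX, transpose_mulVec_response hX,
        partnerVal_eq _ hij h, partnerVal_eq _ hij.symm h.symm, col_eq_residualCol hρ i j, pairScore]
      congr 1; ring
    simp only [errorSet, blockRule, Set.mem_ofPred_eq, e, pairErrorEvent, Set.mem_preimage, Prod.map]
  have hm1 : Measurable fun β : Fin p → ℝ => (β j, β i) := by fun_prop
  have hm2 : Measurable fun z : Fin n → ℝ => (X.col j ⬝ᵥ z, residualCol ρ X i j ⬝ᵥ z) := by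
    unfold dotProduct; fun_prop
  have hT := scale_pos hp
  rw [hset, coefLaw_eq, sqrt_coef_eq hr.le,
    ← map_measureReal_apply (hm1.prodMap hm2) (measurableSet_pairErrorEvent ..),
    ← Measure.map_prod_map _ _ hm1 hm2, map_pi_pair _ hij.symm, map_cols_noiseLaw hρ hX hij h,
    twoPoint_prod_prod_real _ h0 h1 _ (measurableSet_pairErrorEvent ..)]
  have hv : scale p * √r ≠ 0 := (mul_pos hT (Real.sqrt_pos.2 hr)).ne'
  have key (b₁ b₂ : ℝ) (z : ℝ × ℝ) := pairScore_mul hT ρ η u b₁ b₂ z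
  have e1 (b : ℝ) : {z | ((0, scale p * b), z) ∈ pairErrorEvent ρ η (scale p * u)} =
      (fun z => (scale p)⁻¹ • z) ⁻¹' fpSet' ρ η u b := by
    ext z
    have := key 0 b z
    rw [mul_zero] at this
    simp [pairErrorEvent, fpSet', this, abs_mul, abs_of_pos hT, hT]
  have e2 (b : ℝ) : {z | ((scale p * √r, scale p * b), z) ∈ pairErrorEvent ρ η (scale p * u)} =
      (fun z => (scale p)⁻¹ • z) ⁻¹' fnSet ρ η u √r b := by
    ext z
    simp only [pairErrorEvent, fnSet, Set.mem_ofPred_eq, key, abs_mul, abs_of_pos hT, hv, and_false,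
      false_or, ne_eq, not_false_eq_true, and_true, not_lt, Set.mem_preimage, mul_le_mul_iff_right₀ hT]
  have e10 := e1 0
  have e20 := e2 0
  rw [mul_zero] at e10 e20
  rw [e10, e1, e20, e2]
  rfl

/-- This covers a variable without a partner, the last one when `p` is odd. An upper bound is
enough, since one variable cannot lower the exponent. -/
lemma measureReal_error_single (hX : Xᵀ * X = gramMatrix ρ p) {ϑ r u : ℝ}
    (hϑ : 0 ≤ ϑ) (hr : 0 < r) (hu : 0 ≤ u) (hp : 1 < p) (η : ℝ) {j : Fin p}
    (h : ∀ i : Fin p, i ≠ j → i.val / 2 ≠ j.val / 2) :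
    ((coefLaw ϑ r p).prod (noiseLaw n)).real {ω | j ∈
      errorSet (blockRule η (scale p * u) (Xᵀ *ᵥ (X *ᵥ ω.1 + ω.2))) ω.1} ≤
      scaledProb {z | u < |z.1|} p + (p : ℝ) ^ (-ϑ) * scaledProb {z | |√r + z.1| ≤ u} p := by
  obtain ⟨h0, h1⟩ := rpow_neg_mem_Icc hϑ hp.le
  have := isProbabilityMeasure_twoPoint (scale p * √r) h0 h1
  have hT := scale_pos hp
  set A : Set (ℝ × ℝ) := {x | (scale p * u < |x.1 + x.2| ∧ x.1 = 0) ∨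
    (¬ scale p * u < |x.1 + x.2| ∧ x.1 ≠ 0)} with hAdef
  have hset : {ω : (Fin p → ℝ) × (Fin n → ℝ) | j ∈
      errorSet (blockRule η (scale p * u) (Xᵀ *ᵥ (X *ᵥ ω.1 + ω.2))) ω.1} =
      Prod.map (fun β : Fin p → ℝ => β j) (fun z : Fin n → ℝ => X.col j ⬝ᵥ z) ⁻¹' A := by
    ext ω
    have e : score η (scale p * u) ((Xᵀ *ᵥ (X *ᵥ ω.1 + ω.2)) j)
        (partnerVal (Xᵀ *ᵥ (X *ᵥ ω.1 + ω.2)) j) = ω.1 j + X.col j ⬝ᵥ ω.2 := by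
      rw [partnerVal_eq_zero _ h, transpose_mulVec_response hX, partnerVal_eq_zero _ h, score,
        soft_of_abs_le (by simpa using mul_nonneg hT.le hu)]
      ring
    simp only [errorSet, blockRule, Set.mem_ofPred_eq, e, hAdef, Set.mem_preimage, Prod.map]
  have hA : MeasurableSet A := by
    have h1 : MeasurableSet {x : ℝ × ℝ | scale p * u < |x.1 + x.2|} :=
      measurableSet_lt measurable_const (Continuous.measurable (by fun_prop))
    have h2 : MeasurableSet {x : ℝ × ℝ | x.1 = 0} :=
      measurableSet_eq_fun (by fun_prop) measurable_const
    exact (h1.inter h2).union (h1.compl.inter h2.compl)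
  have hm1 : Measurable fun β : Fin p → ℝ => β j := by fun_prop
  have hm2 : Measurable fun z : Fin n → ℝ => X.col j ⬝ᵥ z := by unfold dotProduct; fun_prop
  have hfst (B : Set ℝ) (hB : MeasurableSet B) :
      (gaussianReal 0 1).real B = gauss₂.real (Prod.fst ⁻¹' B) := by
    rw [← map_measureReal_apply measurable_fst hB, gauss₂]
    congr 1
    exact Measure.fst_prod.symm
  have hv : scale p * √r ≠ 0 := (mul_pos hT (Real.sqrt_pos.2 hr)).ne'
  rw [hset, coefLaw_eq, sqrt_coef_eq hr.le, ← map_measureReal_apply (hm1.prodMap hm2) hA,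
    ← Measure.map_prod_map _ _ hm1 hm2,
    (measurePreserving_eval (fun _ => twoPoint ((p : ℝ) ^ (-ϑ)) (scale p * √r)) j).map_eq,
    map_dotProduct_noiseLaw (by simp [col_dotProduct_col hX]), twoPoint_prod_real _ h0 h1 _ hA,
    hfst {z | (0, z) ∈ A} (hA.preimage measurable_prodMk_left),
    hfst {z | (scale p * √r, z) ∈ A} (hA.preimage measurable_prodMk_left)]
  have e1 : Prod.fst ⁻¹' {z : ℝ | (0, z) ∈ A} =
      (fun z : ℝ × ℝ => (scale p)⁻¹ • z) ⁻¹' {z | u < |z.1|} := by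
    ext z
    simp [hAdef, abs_mul, abs_of_pos hT, lt_inv_mul_iff₀ hT]
  have e2 : Prod.fst ⁻¹' {z : ℝ | (scale p * √r, z) ∈ A} =
      (fun z : ℝ × ℝ => (scale p)⁻¹ • z) ⁻¹' {z | |√r + z.1| ≤ u} := by
    ext z
    have : scale p * √r + z.1 = scale p * (√r + (scale p)⁻¹ * z.1) := by field_simp
    simp only [hAdef, Set.mem_ofPred_eq, Set.mem_preimage, hv, and_false, false_or, ne_eq,
      not_false_eq_true, and_true, not_lt, Prod.smul_fst, smul_eq_mul, this, abs_mul, abs_of_pos hT,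
      mul_le_mul_iff_right₀ hT]
  rw [e1, e2]
  refine add_le_add (mul_le_of_le_one_left measureReal_nonneg (by linarith)) le_rfl

lemma expectedHamming_blockRule_bounds (hρ : |ρ| < 1) (hX : Xᵀ * X = gramMatrix ρ p) {ϑ r u : ℝ}
    (hϑ : 0 ≤ ϑ) (hr : 0 < r) (hu : 0 ≤ u) (hp : 1 < p) (η : ℝ) :
    (p - 1) * pairErrorProb ρ η ϑ u √r p ≤
        expectedHamming X ϑ r (fun y => blockRule η (scale p * u) (Xᵀ *ᵥ y)) ∧
      expectedHamming X ϑ r (fun y => blockRule η (scale p * u) (Xᵀ *ᵥ y)) ≤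
        p * pairErrorProb ρ η ϑ u √r p + (scaledProb {z | u < |z.1|} p +
          (p : ℝ) ^ (-ϑ) * scaledProb {z | |√r + z.1| ≤ u} p) := by
  obtain ⟨h0, h1⟩ := rpow_neg_mem_Icc hϑ hp.le
  have hprob : IsFiniteMeasure (coefLaw ϑ r p) := by
    rw [coefLaw_eq]; infer_instance
  rw [expectedHamming_eq_sum]
  swap
  · intro j
    have hc : Continuous fun y : Fin n → ℝ =>
        score η (scale p * u) ((Xᵀ *ᵥ y) j) (partnerVal (Xᵀ *ᵥ y) j) := by
      have : Continuous fun h : Fin p → ℝ => partnerVal h j := by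
        unfold partnerVal
        refine continuous_finsetSum _ fun i _ => ?_
        split_ifs <;> fun_prop
      unfold score
      fun_prop
    exact measurableSet_lt measurable_const hc.abs.measurable
  have hE : 0 ≤ pairErrorProb ρ η ϑ u √r p := by
    have : 0 ≤ 1 - (p : ℝ) ^ (-ϑ) := by linarith
    unfold pairErrorProb scaledProb
    positivity
  have hs : 0 ≤ scaledProb {z | u < |z.1|} p +
      (p : ℝ) ^ (-ϑ) * scaledProb {z | |√r + z.1| ≤ u} p := by
    unfold scaledProb
    positivity
  have hpair {i j : Fin p} := measureReal_error_pair (u := u) hρ hX hϑ hr hp η (i := i) (j := j)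
  have hsingle {j : Fin p} := measureReal_error_single hX hϑ hr hu hp η (j := j)
  obtain ⟨m, rfl⟩ : ∃ m, p = m + 1 := ⟨p - 1, by omega⟩
  rw [Fin.sum_univ_castSucc]
  -- Only the last index can lack a partner: an even index pairs with its successor, an odd one with
  -- its predecessor.
  have hcast (k : Fin m) : ∃ i : Fin (m + 1), i ≠ k.castSucc ∧ i.val / 2 = k.castSucc.val / 2 := by
    rcases Nat.even_or_odd' k.val with ⟨l, hl | hl⟩
    · exact ⟨⟨k + 1, by omega⟩, by simp [Fin.ext_iff], by simp; omega⟩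
    · exact ⟨⟨k - 1, by omega⟩, by simp [Fin.ext_iff]; omega, by simp; omega⟩
  rw [Finset.sum_congr rfl fun k _ => hpair (hcast k).choose_spec.1 (hcast k).choose_spec.2]
  simp only [Finset.sum_const, Finset.card_univ, Fintype.card_fin, nsmul_eq_mul, Nat.cast_add,
    Nat.cast_one]
  refine ⟨?_, ?_⟩
  · rw [add_sub_cancel_right]
    exact le_add_of_nonneg_right measureReal_nonneg
  · by_cases hl : ∃ i : Fin (m + 1), i ≠ Fin.last m ∧ i.val / 2 = (Fin.last m).val / 2
    · obtain ⟨i, hi, hi'⟩ := hl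
      rw [hpair hi hi']
      simp only [Nat.cast_add, Nat.cast_one] at hs
      linarith
    · have := hsingle (j := Fin.last m) fun i h1 h2 => hl ⟨i, h1, h2⟩
      simp only [Nat.cast_add, Nat.cast_one] at this hE
      linarith

end Design

/-! ### The exponent of a block rule -/

lemma eventually_single_error_le {ρ η ϑ u v : ℝ} (hρ : |ρ| < 1) (hu : 0 ≤ u) (hv : 0 ≤ v) :
    ∀ᶠ p : ℕ in atTop, scaledProb {z | u < |z.1|} p +
      (p : ℝ) ^ (-ϑ) * scaledProb {z | |v + z.1| ≤ u} p ≤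
        2 * (p : ℝ) ^ (-(pairExponent ρ η ϑ u v - 1)) := by
  have hA : ∀ z ∈ {z : ℝ × ℝ | u < |z.1|}, rate (fpSet ρ η u 0) ≤ normSq₂ z := by
    intro z hz
    have hz : u < |z.1| := hz
    refine (rate_fpSet_zero_le hρ hu η).trans ?_
    have := pow_le_pow_left₀ hu hz.le 2
    rw [sq_abs] at this
    unfold normSq₂
    nlinarith
  have hB : ∀ z ∈ {z : ℝ × ℝ | |v + z.1| ≤ u}, rate (fnSet ρ η u v 0) ≤ normSq₂ z := by
    intro z hz
    have hz : |v + z.1| ≤ u := hz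
    refine (rate_fnSet_zero_le hρ hu hv η).trans ?_
    have h1 : max 0 (v - u) ≤ |z.1| :=
      max_le (abs_nonneg _) (by linarith [(abs_le.1 hz).2, neg_abs_le z.1])
    have := pow_le_pow_left₀ (le_max_left _ _) h1 2
    rw [sq_abs] at this
    unfold normSq₂
    nlinarith
  -- The crude loss `ε = 1` is affordable: the total error of the paired variables carries an extra
  -- factor `p`.
  filter_upwards [gauss₂_upper (rate_nonneg _) hA one_pos, gauss₂_upper (rate_nonneg _) hB one_pos,
    eventually_gt_atTop 0] with p h1 h2 hp
  have hp1 : (1 : ℝ) ≤ p := by exact_mod_cast hp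
  have hp0 : (0 : ℝ) < p := by linarith
  have e1 : pairExponent ρ η ϑ u v ≤ rate (fpSet ρ η u 0) :=
    (min_le_left _ _).trans (min_le_left _ _)
  have e2 : pairExponent ρ η ϑ u v ≤ ϑ + rate (fnSet ρ η u v 0) :=
    (min_le_right _ _).trans (min_le_left _ _)
  have h3 : scaledProb {z | u < |z.1|} p ≤ (p : ℝ) ^ (-(pairExponent ρ η ϑ u v - 1)) :=
    h1.trans (Real.rpow_le_rpow_of_exponent_le hp1 (by linarith))
  have h4 : (p : ℝ) ^ (-ϑ) * scaledProb {z | |v + z.1| ≤ u} p ≤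
      (p : ℝ) ^ (-(pairExponent ρ η ϑ u v - 1)) := by
    refine (mul_le_mul_of_nonneg_left h2 (by positivity)).trans ?_
    rw [← Real.rpow_add hp0]
    exact Real.rpow_le_rpow_of_exponent_le hp1 (by linarith)
  linarith

/-- The expected Hamming error of a block rule has the exponent `pairExponent`. -/
theorem isHammingExponent_blockRule {ρ ϑ r q η : ℝ} (hρ : |ρ| < 1) {n : ℕ → ℕ}
    {X : ∀ p, Matrix (Fin (n p)) (Fin p) ℝ} (hX : ∀ p, (X p)ᵀ * X p = gramMatrix ρ p)
    (hϑ : 0 < ϑ) (hr : 0 < r) (hq : 0 < q) :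
    IsHammingExponent (fun p => expectedHamming (X p) ϑ r
      (fun y => blockRule η (level q p) ((X p)ᵀ *ᵥ y))) (pairExponent ρ η ϑ √q √r) := by
  rw [isHammingExponent_iff]
  set h := pairExponent ρ η ϑ √q √r with hh
  have hu := Real.sqrt_pos.2 hq
  have hf : HasOrder (fun p : ℕ => (p : ℝ) * pairErrorProb ρ η ϑ √q √r p) (h - 1) := by
    have := (hasOrder_rpow (-1)).mul (hasOrder_pairErrorProb (η := η) (v := √r) hρ hϑ hu)
    simp only [neg_neg, Real.rpow_one] at this
    rwa [neg_add_eq_sub] at this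
  have hg := hf.add (hasOrder_rpow (h - 1))
  rw [min_self] at hg
  -- The constants `2` and `1 / 2` absorb the error of the last variable and the bound `p - 1 ≥ p /
  -- 2`.
  have hg2 := hg.of_le_mul (C := 2) (g := fun p : ℕ => 2 * ((p : ℝ) * pairErrorProb ρ η ϑ √q √r p +
    (p : ℝ) ^ (-(h - 1)))) two_pos (.of_forall fun _ => le_rfl) (.of_forall fun _ => le_rfl)
  have hf2 := hf.of_le_mul (C := 1 / 2) (g := fun p : ℕ => 1 / 2 * ((p : ℝ) *
    pairErrorProb ρ η ϑ √q √r p)) one_half_pos (.of_forall fun _ => le_rfl)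
    (.of_forall fun _ => le_rfl)
  intro ε hε
  filter_upwards [hf2 ε hε, hg2 ε hε, hf ε hε, eventually_gt_atTop 1,
    eventually_single_error_le (ρ := ρ) (η := η) (ϑ := ϑ) hρ hu.le (Real.sqrt_nonneg r)]
    with p h1 h2 h3 hp h4
  obtain ⟨hlo, hup⟩ := expectedHamming_blockRule_bounds hρ (hX p) hϑ.le hr hu.le hp η
  rw [level_eq hq.le]
  have hp2 : (2 : ℝ) ≤ p := by exact_mod_cast hp
  have hE : 0 ≤ (p : ℝ) * pairErrorProb ρ η ϑ √q √r p := le_trans (by positivity) h3.1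
  have hE' : 0 ≤ pairErrorProb ρ η ϑ √q √r p := nonneg_of_mul_nonneg_right hE (by linarith)
  constructor
  · refine h1.1.trans (le_trans ?_ hlo)
    nlinarith
  · refine hup.trans (le_trans ?_ h2.2)
    linarith

/-! ### From exponents to phase curves -/

section Curves

variable {ρ ϑ : ℝ} {n : ℕ → ℕ} {X : ∀ p, Matrix (Fin (n p)) (Fin p) ℝ}
  {M : ℝ → ∀ p, (Fin (n p) → ℝ) → Set (Fin p)} {s : ℝ}

/-- Exponents are unique, so ideal tuning reduces to a supremum over the explicit `pairExponent`.
The rules need to agree only for `p > 1`, where the threshold is positive. -/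
lemma isRateExponent_iff (hρ : |ρ| < 1) (hX : ∀ p, (X p)ᵀ * X p = gramMatrix ρ p) (hϑ : 0 < ϑ)
    (hM : ∀ q, 0 < q → ∀ p, 1 < p → ∀ y, M q p y = blockRule (s * ρ) (level q p) ((X p)ᵀ *ᵥ y))
    {r q h : ℝ} (hr : 0 < r) (hq : 0 < q) :
    IsRateExponent X ϑ r (M q) h ↔ h = pairExponent ρ (s * ρ) ϑ √q √r := by
  have h1 := isHammingExponent_iff.1
    (isHammingExponent_blockRule (η := s * ρ) hρ hX hϑ hr hq)
  have h2 : HasOrder (fun p => expectedHamming (X p) ϑ r (M q p))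
      (pairExponent ρ (s * ρ) ϑ √q √r - 1) := by
    refine h1.congr ?_
    filter_upwards [eventually_gt_atTop 1] with p hp
    rw [show M q p = _ from funext (hM q hq p hp)]
  rw [IsRateExponent, isHammingExponent_iff]
  constructor
  · intro h
    linarith [h.unique h2]
  · rintro rfl
    exact h2

lemma upperPhaseCurve_eq (hρ : |ρ| < 1) (hX : ∀ p, (X p)ᵀ * X p = gramMatrix ρ p)
    (hϑ : ϑ ∈ Set.Ioo (0 : ℝ) 1) (hs : s ∈ Set.Icc (0 : ℝ) 1)
    (hM : ∀ q, 0 < q → ∀ p, 1 < p → ∀ y, M q p y = blockRule (s * ρ) (level q p) ((X p)ᵀ *ᵥ y)) :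
    upperPhaseCurve X M ϑ = phaseCurve ρ ϑ (s * |ρ|) := by
  unfold upperPhaseCurve phaseCurve
  refine iInf_congr fun r => iInf_congr fun hr => iInf_congr_Prop ?_ fun _ => rfl
  rw [← exists_one_lt_pairExponent_iff hρ hϑ hs (Real.sqrt_pos.2 hr)]
  simp only [idealExponent, lt_iSup_iff]
  constructor
  · rintro ⟨q, hq, h, hh, h1⟩
    rw [isRateExponent_iff hρ hX hϑ.1 hM hr hq] at hh
    exact ⟨√q, Real.sqrt_pos.2 hq, by rw [← hh]; exact_mod_cast h1⟩
  · rintro ⟨u, hu, h1⟩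
    refine ⟨u ^ 2, by positivity, _,
      (isRateExponent_iff hρ hX hϑ.1 hM hr (by positivity)).2 rfl, ?_⟩
    rw [Real.sqrt_sq hu.le]
    exact_mod_cast h1

end Curves

end SparseRegression

end

/-! ### Proof of the proposition -/

theorem mainTheorem2 (ρ : ℝ) (hρ : |ρ| < 1) (n : ℕ → ℕ)
    (X : ∀ p, Matrix (Fin (n p)) (Fin p) ℝ)
    (hX : ∀ p, (X p)ᵀ * X p = SparseRegression.gramMatrix ρ p)
    (ϑ : ℝ) (hϑ : ϑ ∈ Set.Ioo (0 : ℝ) 1) :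
    MonotoneOn
        (fun μ : ℝ => SparseRegression.upperPhaseCurve X (SparseRegression.elasticNet X μ) ϑ)
        (Set.Ioi 0) ∧
      Tendsto
        (fun μ : ℝ => SparseRegression.upperPhaseCurve X (SparseRegression.elasticNet X μ) ϑ)
        (𝓝[>] 0)
        (𝓝 (SparseRegression.upperPhaseCurve X (SparseRegression.lasso X) ϑ)) ∧
      Tendsto
        (fun μ : ℝ => SparseRegression.upperPhaseCurve X (SparseRegression.elasticNet X μ) ϑ)
        atTop
        (𝓝 (SparseRegression.upperPhaseCurve X (SparseRegression.marginalRegression X) ϑ)) ∧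
      (ρ ≤ -(1 / 2) → ϑ ≤ 1 / 2 →
        SparseRegression.upperPhaseCurve X (SparseRegression.marginalRegression X) ϑ = ⊤ ∧
        ∀ r : ℝ, 0 < r → ∀ q : ℝ, 0 < q → ∃ h : ℝ, h ≤ 1 ∧
          SparseRegression.IsRateExponent X ϑ r (SparseRegression.marginalRegression X q) h) := by
  open SparseRegression in
  have hEN : ∀ μ : ℝ, 0 < μ →
      upperPhaseCurve X (elasticNet X μ) ϑ = phaseCurve ρ ϑ ((1 + μ)⁻¹ * |ρ|) := fun μ hμ =>
    upperPhaseCurve_eq hρ hX hϑ ⟨by positivity, inv_le_one_of_one_le₀ (by linarith)⟩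
      fun q hq p hp y => elasticNet_eq hρ hX hμ.le hq hp y
  have hLasso : upperPhaseCurve X (lasso X) ϑ = phaseCurve ρ ϑ (1 * |ρ|) :=
    upperPhaseCurve_eq hρ hX hϑ (by simp) fun q hq p hp y => lasso_eq hρ hX hq hp y
  have hMRrule : ∀ q : ℝ, 0 < q → ∀ p, 1 < p → ∀ y, marginalRegression X q p y =
      blockRule (0 * ρ) (level q p) ((X p)ᵀ *ᵥ y) := fun q _ p _ y => marginalRegression_eq y
  have hMR : upperPhaseCurve X (marginalRegression X) ϑ = phaseCurve ρ ϑ (0 * |ρ|) :=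
    upperPhaseCurve_eq hρ hX hϑ (by simp) hMRrule
  rw [hLasso, hMR]
  have hEN0 : (fun μ : ℝ => phaseCurve ρ ϑ ((1 + μ)⁻¹ * |ρ|)) =ᶠ[𝓝[>] 0]
      fun μ => upperPhaseCurve X (elasticNet X μ) ϑ := by
    filter_upwards [self_mem_nhdsWithin] with μ hμ using (hEN μ hμ).symm
  have hENtop : (fun μ : ℝ => phaseCurve ρ ϑ ((1 + μ)⁻¹ * |ρ|)) =ᶠ[atTop]
      fun μ => upperPhaseCurve X (elasticNet X μ) ϑ := by
    filter_upwards [eventually_gt_atTop 0] with μ hμ using (hEN μ hμ).symm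
  refine ⟨(monotoneOn_phaseCurve_div hρ).congr fun μ hμ => (hEN μ hμ).symm,
    (tendsto_phaseCurve_div hρ hϑ.2 (by simp) self_mem_nhdsWithin ?_).congr' hEN0,
    (tendsto_phaseCurve_div hρ hϑ.2 (by simp) (eventually_gt_atTop 0) ?_).congr' hENtop,
    fun hρ' hϑ' => ⟨?_, fun r hr q hq => ?_⟩⟩
  · have h : ContinuousAt (fun μ : ℝ => (1 + μ)⁻¹) 0 :=
      ContinuousAt.inv₀ (by fun_prop) (by norm_num)
    have := h.tendsto
    simp only [add_zero, inv_one] at this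
    exact this.mono_left nhdsWithin_le_nhds
  · exact tendsto_inv_atTop_zero.comp (tendsto_atTop_add_const_left _ _ tendsto_id)
  · rw [zero_mul]
    exact phaseCurve_zero_eq_top hρ hρ' hϑ'
  · refine ⟨_, ?_, (isRateExponent_iff hρ hX hϑ.1 hMRrule hr hq).2 rfl⟩
    -- An exponent above one at this single threshold would already give `PhaseCond` at `e = 0`.
    by_contra! hlt
    have := (exists_one_lt_pairExponent_iff (s := 0) hρ hϑ (by simp) (Real.sqrt_pos.2 hr)).1
      ⟨√q, Real.sqrt_pos.2 hq, hlt⟩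
    rw [zero_mul] at this
    exact not_phaseCond_zero hρ hρ' hϑ' _ (Real.sqrt_nonneg r) this
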